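/- **Setting.** Let $E=\{1,\dots,L\}$ with $L\ge 2$, let $\mathcal A\subseteq\{A\subseteq E:|A|\le K\}$, and let $\Phi\in\mathbb R^{L\times d}$ have rows $\phi_e^T$ with $\|\phi_e\|_2\le 1$ for all $e\in E$. For $w\in\mathbb R^L$ put $f(A,w)=\sum_{e\in A}w(e)$. Let $\mathtt{ORACLE}$ be any (possibly approximate, possibly randomized) algorithm that maps a weight vector $w\in\mathbb R^L$, using fresh internal randomness that is independent of everything else in each call, to a set $\mathtt{ORACLE}(w)\in\mathcal A$. Let $\lambda\ge\sigma>0$. *Coherent Gaussian case:* $\theta^*\sim N(0,\lambda^2 I)$ in $\mathbb R^d$, $\bar w=\Phi\theta^*$, and in episode $t=1,2,\dots$ the weights are $w_t=\bar w+\eta_t$, where the noises $\eta_t(e)$ are i.i.d. $N(0,\sigma^2)$ over all $t$ and $e$, independent of $\theta^*$. *CombLinTS with parameters $(\Phi,\lambda,\sigma)$:* start with $\bar\theta_1=0$, $\Sigma_1=\lambda^2 I$. In episode $t$, sample $\theta_t\sim N(\bar\theta_t,\Sigma_t)$, choose $A^t=\mathtt{ORACLE}(\Phi\theta_t)$, and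 observe $w_t(e)$ for $e\in A^t$. Then obtain $(\bar\theta_{t+1},\Sigma_{t+1})$ from $(\bar\theta_t,\Sigma_t)$ by performing, for each $e\in A^t$ in turn, the Kalman update $$\bar\theta\leftarrow\Big[I-\frac{\Sigma\phi_e\phi_e^T}{\phi_e^T\Sigma\phi_e+\sigma^2}\Big]\bar\theta+\frac{\Sigma\phi_e}{\phi_e^T\Sigma\phi_e+\sigma^2}\,w_t(e),\qquad \Sigma\leftarrow\Sigma-\frac{\Sigma\phi_e\phi_e^T\Sigma}{\phi_e^T\Sigma\phi_e+\sigma^2}.$$ *Regret:* let $A^*=\mathtt{ORACLE}(\bar w)$, $R_t=f(A^*,w_t)-f(A^t,w_t)$, and $R_{\mathrm{Bayes}}(n)=\sum_{t=1}^n\mathbb E[R_t]$, where the expectation is over $\theta^*$, the noise, the sampling and the internal randomness of the oracle. **Theorem 1.** There are universal constants $C>0$ and $p\in\mathbb N$ such that in every such setting, and for every $n$, the regrets $R_t$ are integrable and $$R_{\mathrm{Bayes}}(n)\le C\,\big(\ln(2+nKd)\big)^p\; K\lambda\sqrt{d\,n\,\min\{\ln L,\,d\}},$$ that is, $R_{\mathrm{Bayes}}(n)=\tilde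 O\big(K\lambda\sqrt{dn\min\{\ln L,d\}}\big)$. -/

import Mathlib

open MeasureTheory ProbabilityTheory
open scoped MatrixOrder Matrix

namespace CombLinTS

noncomputable section

/-- The parameter space `ℝ^d` with its Euclidean norm. -/
abbrev Param (d : ℕ) : Type := EuclideanSpace ℝ (Fin d)

/-- The feature vector `φ_e`: the (transposed) row of index `e` of the matrix `Φ`. -/
def feature {L d : ℕ} (Φ : Matrix (Fin L) (Fin d) ℝ) (e : Fin L) : Param d :=
  WithLp.toLp 2 (Φ e)

/-- The weight vector `Φ θ`. -/
def linWeight {L d : ℕ} (Φ : Matrix (Fin L) (Fin d) ℝ) (θ : Param d) : Fin L → ℝ :=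
  Φ *ᵥ θ.ofLp

/-- The modular return `f(A, w) = ∑_{e ∈ A} w(e)`. -/
def setReturn {L : ℕ} (A : Finset (Fin L)) (w : Fin L → ℝ) : ℝ :=
  ∑ e ∈ A, w e

/-- The state of the learning agent: the mean vector `θ̄_t` and the covariance matrix `Σ_t`. -/
abbrev Belief (d : ℕ) : Type := Param d × Matrix (Fin d) (Fin d) ℝ

/-- One Kalman update of the mean vector `p.1` and the covariance matrix `p.2`, for a feature
vector `φ` and an observation `w`. -/
def kalmanStep {d : ℕ} (σ : ℝ) (φ : Param d) (w : ℝ) (p : Belief d) : Belief d :=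
  let s : ℝ := φ.ofLp ⬝ᵥ (p.2 *ᵥ φ.ofLp) + σ ^ 2
  let F : Matrix (Fin d) (Fin d) ℝ := Matrix.vecMulVec φ.ofLp φ.ofLp
  (WithLp.toLp 2
      ((1 - s⁻¹ • (p.2 * F)) *ᵥ p.1.ofLp + w • (s⁻¹ • (p.2 *ᵥ φ.ofLp))),
    p.2 - s⁻¹ • (p.2 * F * p.2))

/-- Kalman filtering: the items of `A` are processed one after the other (in increasing order);
only the weights `w e` with `e ∈ A` are used. -/
def kalmanFilter {L d : ℕ} (Φ : Matrix (Fin L) (Fin d) ℝ) (σ : ℝ) (A : Finset (Fin L))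
    (w : Fin L → ℝ) (p : Belief d) : Belief d :=
  (A.sort (· ≤ ·)).foldl (fun q e => kalmanStep σ (feature Φ e) (w e) q) p

/-- The vector `θ̄ + Σ^{1/2} z`. For `z` standard Gaussian it is a sample of `N(θ̄, Σ)`, see
`map_gaussianSample`. -/
def gaussianSample {d : ℕ} (p : Belief d) (z : Param d) : Param d :=
  p.1 + Matrix.toEuclideanCLM (𝕜 := ℝ) (CFC.sqrt p.2) z

theorem map_gaussianSample {d : ℕ} (p : Belief d) :
    (stdGaussian (Param d)).map (gaussianSample p) = multivariateGaussian p.1 p.2 := rfl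

/-- The randomness of one episode: a standard Gaussian vector used for the sampling of `θ_t`,
the internal random seed of the oracle, and the noise vector `η_t`. -/
abbrev EpisodeNoise (L d : ℕ) (S : Type*) : Type _ := Param d × S × (Fin L → ℝ)

/-- A sample point: the unknown parameter `θ*`, the oracle seed used to compute `A*`, and
the randomness of the episodes `0, 1, 2, …`. -/
abbrev Sample (L d : ℕ) (S : Type*) : Type _ := Param d × S × (ℕ → EpisodeNoise L d S)

/-- The law of the randomness of one episode: `N(0, I) ⊗ ν ⊗ N(0, σ²)^L`. -/
def episodeLaw {S : Type*} [MeasurableSpace S] (L d : ℕ) (σ : ℝ) (ν : Measure S) :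
    Measure (EpisodeNoise L d S) :=
  (stdGaussian (Param d)).prod
    (ν.prod (Measure.pi fun _ : Fin L => gaussianReal 0 (Real.toNNReal (σ ^ 2))))

instance {S : Type*} [MeasurableSpace S] (L d : ℕ) (σ : ℝ) (ν : Measure S)
    [IsProbabilityMeasure ν] : IsProbabilityMeasure (episodeLaw L d σ ν) := by
  unfold episodeLaw; infer_instance

/-- The coherent Gaussian case: `θ* ∼ N(0, lam² I)`, the noises are i.i.d. `N(0, σ²)`, and all
the sources of randomness are independent. -/
def law {S : Type*} [MeasurableSpace S] (L d : ℕ) (lam σ : ℝ) (ν : Measure S)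
    [IsProbabilityMeasure ν] : Measure (Sample L d S) :=
  (multivariateGaussian (0 : Param d) (lam ^ 2 • (1 : Matrix (Fin d) (Fin d) ℝ))).prod
    (ν.prod (Measure.infinitePi fun _ : ℕ => episodeLaw L d σ ν))

section Protocol

variable {L d : ℕ} {S : Type*} (Φ : Matrix (Fin L) (Fin d) ℝ) (lam σ : ℝ)
  (oracle : (Fin L → ℝ) → S → Finset (Fin L))

/-- The reference solution `A* = ORACLE(w̄)` for the mean weight `w̄ = Φ θ*`. -/
def refSet (ω : Sample L d S) : Finset (Fin L) :=
  oracle (linWeight Φ ω.1) ω.2.1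

/-- The realized weight vector of episode `t`: `w_t = Φ θ* + η_t`. -/
def weight (t : ℕ) (ω : Sample L d S) : Fin L → ℝ :=
  linWeight Φ ω.1 + (ω.2.2 t).2.2

/-- The set that the agent chooses when its state is `p` and the randomness of the episode
is `x`: sample `θ_t ∼ N(θ̄_t, Σ_t)` and call the oracle on `Φ θ_t`. -/
def chooseSet (p : Belief d) (x : EpisodeNoise L d S) : Finset (Fin L) :=
  oracle (linWeight Φ (gaussianSample p x.1)) x.2.1

/-- The state `(θ̄_t, Σ_t)` of the agent at the start of episode `t`, episodes being counted
from `0`; it starts at `(0, lam² I)`. -/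
def belief : ℕ → Sample L d S → Belief d
  | 0, _ => (0, lam ^ 2 • (1 : Matrix (Fin d) (Fin d) ℝ))
  | t + 1, ω =>
    kalmanFilter Φ σ (chooseSet Φ oracle (belief t ω) (ω.2.2 t)) (weight Φ t ω) (belief t ω)

/-- The set `A^t` chosen in episode `t`. -/
def chosenSet (t : ℕ) (ω : Sample L d S) : Finset (Fin L) :=
  chooseSet Φ oracle (belief Φ lam σ oracle t ω) (ω.2.2 t)

/-- The realized regret `R_t = f(A*, w_t) - f(A^t, w_t)` of episode `t`. -/
def realizedRegret (t : ℕ) (ω : Sample L d S) : ℝ :=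
  setReturn (refSet Φ oracle ω) (weight Φ t ω) -
    setReturn (chosenSet Φ lam σ oracle t ω) (weight Φ t ω)

/-- The Bayes cumulative regret of the first `n` episodes: the sum of the expectations of the
realized regrets, over `θ*`, the weights, the sampling and the oracle. -/
def bayesRegret [MeasurableSpace S] (ν : Measure S) [IsProbabilityMeasure ν] (n : ℕ) : ℝ :=
  ∑ t ∈ Finset.range n, ∫ ω, realizedRegret Φ lam σ oracle t ω ∂(law L d lam σ ν)

end Protocol

end

end CombLinTS

/-! The argument is posterior sampling, Gaussian maximal inequality, elliptical potential.

Given the first `t` episodes, `θ*` has law `N(θ̄_t, Σ_t)`: the Kalman filter computes the exact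
posterior (`map_observation`, `lintegral_belief`). So `θ*` and `θ_t` are, conditionally, independent
with one and the same law, and `A*`, `A^t` are the same function of (parameter, oracle seed)
evaluated at two independent copies. Nothing is needed about the quality of the oracle. The terms
`f(A*, Φ θ̄_t)` and `f(A^t, Φ θ̄_t)` have equal means; `f(A^t, Φ(θ* - θ̄_t))` and both noise terms
have mean zero. The expected regret of the episode is thus `E f(A*, Φ(θ* - θ̄_t))`.

Write `θ* - θ̄_t = Σ_t^{1/2} z` and `u_e = Σ_t^{1/2} φ_e`. A single random variable `M(z)` with mean
at most `8 min(log L, d)` satisfies `⟨u_e, z⟩² ≤ ‖u_e‖² M(z)` for all `e`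
(`exists_integrable_bound_sq_inner`). The arithmetic-geometric mean inequality with a free parameter
`γ` bounds the regret by `(K/γ · ∑_{e ∈ A*} ‖u_e‖² + γ M)/2`. In expectation `A*` may be exchanged
with `A^t` in the variance sum, again by equality of laws (`integral_regret_le`).

It remains to bound the summed variances of the items actually observed. Each episode divides `det
Σ` by at least `1 + totalVar/σ²`, while `det Σ_n` is bounded below through the trace of the
precision matrix. This gives `∑ totalVar ≤ K λ² d (1 + log(nd)/log 2)` for every sample point
(`sum_totalVar_le`). Optimizing `γ` after summing over episodes plays the role of Cauchy–Schwarz and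
yields the square root. -/

namespace CombLinTS

/-! ### Covariance update: inverse, determinant, quadratic form -/

section Covariance

open Matrix

variable {d : ℕ}

/-- The covariance part of a Kalman update. -/
noncomputable def covStep (σ : ℝ) (v : Fin d → ℝ) (M : Matrix (Fin d) (Fin d) ℝ) :
    Matrix (Fin d) (Fin d) ℝ :=
  M - (v ⬝ᵥ (M *ᵥ v) + σ ^ 2)⁻¹ • (M * vecMulVec v v * M)

theorem kalmanStep_snd (σ : ℝ) (φ : Param d) (w : ℝ) (p : Belief d) :
    (kalmanStep σ φ w p).2 = covStep σ φ.ofLp p.2 := rfl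

theorem dotProduct_mulVec_comm_of_isHermitian {M : Matrix (Fin d) (Fin d) ℝ} (hM : M.IsHermitian)
    (u v : Fin d → ℝ) : u ⬝ᵥ (M *ᵥ v) = v ⬝ᵥ (M *ᵥ u) := by
  have h : Mᵀ = M := by rw [← conjTranspose_eq_transpose_of_trivial, hM.eq]
  rw [dotProduct_mulVec, ← mulVec_transpose, h, dotProduct_comm]

theorem vecMulVec_self_posSemidef (v : Fin d → ℝ) : (vecMulVec v v).PosSemidef := by
  simpa using posSemidef_vecMulVec_self_star v

theorem dotProduct_mulVec_self_nonneg {M : Matrix (Fin d) (Fin d) ℝ} (hM : M.PosSemidef)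
    (v : Fin d → ℝ) : 0 ≤ v ⬝ᵥ (M *ᵥ v) := by
  simpa using hM.dotProduct_mulVec_nonneg v

/-- Sherman–Morrison: an observation adds a rank-one term to the precision matrix. Positive
definiteness and the trace and determinant formulas all follow from this form. -/
theorem covStep_mul_add {σ : ℝ} (hσ : 0 < σ) (v : Fin d → ℝ) {M : Matrix (Fin d) (Fin d) ℝ}
    (hM : M.PosDef) : covStep σ v M * (M⁻¹ + (σ ^ 2)⁻¹ • vecMulVec v v) = 1 := by
  have hdet : IsUnit M.det := (isUnit_iff_isUnit_det _).1 hM.isUnit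
  have hq := dotProduct_mulVec_self_nonneg hM.posSemidef v
  have hF : vecMulVec v v * M * vecMulVec v v = (v ⬝ᵥ (M *ᵥ v)) • vecMulVec v v := by
    rw [mul_assoc, mul_vecMulVec, vecMulVec_mul_vecMulVec, vecMulVec_smul]
  have hF' : M * vecMulVec v v * M * vecMulVec v v
      = (v ⬝ᵥ (M *ᵥ v)) • (M * vecMulVec v v) := by
    rw [mul_assoc, mul_assoc, ← mul_assoc (vecMulVec v v), hF, Matrix.mul_smul]
  have hF'' : M * vecMulVec v v * M * M⁻¹ = M * vecMulVec v v := by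
    rw [mul_assoc, mul_nonsing_inv _ hdet, mul_one]
  rw [covStep, sub_mul, mul_add, mul_add, mul_nonsing_inv _ hdet]
  simp only [Matrix.smul_mul, Matrix.mul_smul, hF', hF'']
  generalize M * vecMulVec v v = N
  generalize v ⬝ᵥ (M *ᵥ v) = q at hq
  have h0 : (σ ^ 2)⁻¹ = (q + σ ^ 2)⁻¹ + (σ ^ 2)⁻¹ * ((q + σ ^ 2)⁻¹ * q) := by
    field_simp
    ring
  simp only [smul_smul]
  have : (σ ^ 2)⁻¹ • N - ((q + σ ^ 2)⁻¹ • N + ((σ ^ 2)⁻¹ * ((q + σ ^ 2)⁻¹ * q)) • N) = 0 := by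
    rw [← add_smul, ← h0, sub_self]
  rw [add_sub_assoc]
  rw [this, add_zero]

theorem add_vecMulVec_posDef {σ : ℝ} (v : Fin d → ℝ) {M : Matrix (Fin d) (Fin d) ℝ}
    (hM : M.PosDef) : (M⁻¹ + (σ ^ 2)⁻¹ • vecMulVec v v).PosDef :=
  hM.inv.add_posSemidef ((vecMulVec_self_posSemidef v).smul (by positivity))

theorem covStep_eq_inv {σ : ℝ} (hσ : 0 < σ) (v : Fin d → ℝ) {M : Matrix (Fin d) (Fin d) ℝ}
    (hM : M.PosDef) : covStep σ v M = (M⁻¹ + (σ ^ 2)⁻¹ • vecMulVec v v)⁻¹ :=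
  (inv_eq_left_inv (covStep_mul_add hσ v hM)).symm

theorem covStep_posDef {σ : ℝ} (hσ : 0 < σ) (v : Fin d → ℝ) {M : Matrix (Fin d) (Fin d) ℝ}
    (hM : M.PosDef) : (covStep σ v M).PosDef := by
  rw [covStep_eq_inv hσ v hM]
  exact (add_vecMulVec_posDef v hM).inv

theorem trace_inv_covStep {σ : ℝ} (hσ : 0 < σ) (v : Fin d → ℝ) {M : Matrix (Fin d) (Fin d) ℝ}
    (hM : M.PosDef) : (covStep σ v M)⁻¹.trace = M⁻¹.trace + (v ⬝ᵥ v) / σ ^ 2 := by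
  rw [covStep_eq_inv hσ v hM, nonsing_inv_nonsing_inv, trace_add, trace_smul, trace_vecMulVec,
    smul_eq_mul, div_eq_inv_mul]
  exact (isUnit_iff_isUnit_det _).1 (add_vecMulVec_posDef v hM).isUnit

/-- Matrix determinant lemma, applied to the rank-one change of the precision matrix. -/
theorem det_covStep {σ : ℝ} (hσ : 0 < σ) (v : Fin d → ℝ) {M : Matrix (Fin d) (Fin d) ℝ}
    (hM : M.PosDef) : M.det = (covStep σ v M).det * (1 + (v ⬝ᵥ (M *ᵥ v)) / σ ^ 2) := by
  have h := congrArg det (covStep_mul_add hσ v hM)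
  have hdet : IsUnit M⁻¹.det := (isUnit_iff_isUnit_det _).1 hM.inv.isUnit
  have hdet' : IsUnit M.det := (isUnit_iff_isUnit_det _).1 hM.isUnit
  have hvec : (σ ^ 2)⁻¹ • vecMulVec v v
      = replicateCol Unit ((σ ^ 2)⁻¹ • v) * replicateRow Unit v := by
    rw [← vecMulVec_eq, smul_vecMulVec]
  rw [det_mul, det_one, hvec, det_add_replicateCol_mul_replicateRow hdet,
    nonsing_inv_nonsing_inv _ hdet', det_nonsing_inv, Ring.inverse_eq_inv'] at h
  have h2 : (1 + replicateRow Unit v * M * replicateCol Unit ((σ ^ 2)⁻¹ • v)).det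
      = 1 + (v ⬝ᵥ (M *ᵥ v)) / σ ^ 2 := by
    rw [det_unique, Matrix.mul_assoc, Matrix.add_apply, one_apply_eq, mul_apply]
    simp only [replicateRow_apply, div_eq_inv_mul, ← smul_eq_mul (a := (σ ^ 2)⁻¹),
      ← dotProduct_smul, ← mulVec_smul]
    rfl
  rw [h2] at h
  have h3 := hM.det_pos
  field_simp at h ⊢
  linarith

theorem dotProduct_covStep_mulVec (σ : ℝ) (v u : Fin d → ℝ) {M : Matrix (Fin d) (Fin d) ℝ}
    (hM : M.IsHermitian) :
    u ⬝ᵥ (covStep σ v M *ᵥ u)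
      = u ⬝ᵥ (M *ᵥ u) - (v ⬝ᵥ (M *ᵥ u)) ^ 2 / (v ⬝ᵥ (M *ᵥ v) + σ ^ 2) := by
  rw [covStep, sub_mulVec, dotProduct_sub, smul_mulVec, dotProduct_smul, ← mulVec_mulVec,
    ← mulVec_mulVec, vecMulVec_mulVec, op_smul_eq_smul, mulVec_smul, dotProduct_smul,
    dotProduct_mulVec_comm_of_isHermitian hM u v, smul_eq_mul, smul_eq_mul, div_eq_inv_mul, ← sq]

theorem sq_dotProduct_mulVec_le {M : Matrix (Fin d) (Fin d) ℝ} (hM : M.PosSemidef)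
    (u v : Fin d → ℝ) :
    (v ⬝ᵥ (M *ᵥ u)) ^ 2 ≤ (u ⬝ᵥ (M *ᵥ u)) * (v ⬝ᵥ (M *ᵥ v)) := by
  have h (t : ℝ) : 0 ≤ (v ⬝ᵥ (M *ᵥ v)) * (t * t) + (2 * (v ⬝ᵥ (M *ᵥ u))) * t
      + u ⬝ᵥ (M *ᵥ u) := by
    have h1 := dotProduct_mulVec_self_nonneg hM (t • v + u)
    simp only [mulVec_add, mulVec_smul, dotProduct_add, add_dotProduct, dotProduct_smul,
      smul_dotProduct, smul_eq_mul, dotProduct_mulVec_comm_of_isHermitian hM.1 u v] at h1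
    linarith
  have h2 := discrim_le_zero h
  rw [discrim] at h2
  nlinarith

theorem dotProduct_covStep_mulVec_le {σ : ℝ} (v u : Fin d → ℝ)
    {M : Matrix (Fin d) (Fin d) ℝ} (hM : M.PosSemidef) :
    u ⬝ᵥ (covStep σ v M *ᵥ u) ≤ u ⬝ᵥ (M *ᵥ u) := by
  rw [dotProduct_covStep_mulVec σ v u hM.1]
  have := dotProduct_mulVec_self_nonneg hM v
  have : 0 ≤ (v ⬝ᵥ (M *ᵥ u)) ^ 2 / (v ⬝ᵥ (M *ᵥ v) + σ ^ 2) := by positivity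
  linarith

/-- After clearing denominators, the difference of the two sides is `(s q - r²)/σ²`, nonnegative by
Cauchy–Schwarz for `M`. It limits how much one observation can shrink any variance, so that
variances taken at the start of an episode can be used although the items are processed one by one.
-/
theorem dotProduct_mulVec_le_covStep {σ : ℝ} (hσ : 0 < σ) (v u : Fin d → ℝ)
    {M : Matrix (Fin d) (Fin d) ℝ} (hM : M.PosSemidef) :
    u ⬝ᵥ (M *ᵥ u) ≤ (1 + (v ⬝ᵥ (M *ᵥ v)) / σ ^ 2) * (u ⬝ᵥ (covStep σ v M *ᵥ u)) := by
  rw [dotProduct_covStep_mulVec σ v u hM.1]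
  have h1 := dotProduct_mulVec_self_nonneg hM v
  have h2 := sq_dotProduct_mulVec_le hM u v
  generalize v ⬝ᵥ (M *ᵥ v) = q at *
  generalize v ⬝ᵥ (M *ᵥ u) = r at *
  generalize u ⬝ᵥ (M *ᵥ u) = s at *
  have : (1 + q / σ ^ 2) * (s - r ^ 2 / (q + σ ^ 2)) = s + (s * q - r ^ 2) / σ ^ 2 := by
    field_simp
    ring
  rw [this]
  have : 0 ≤ (s * q - r ^ 2) / σ ^ 2 := div_nonneg (by linarith) (by positivity)
  linarith

end Covariance

/-! ### Effect of a whole episode on the covariance -/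

section Filter

variable {L d : ℕ} {Φ : Matrix (Fin L) (Fin d) ℝ}

theorem feature_dotProduct_self_le (hΦ : ∀ e, ‖feature Φ e‖ ≤ 1) (e : Fin L) :
    Φ e ⬝ᵥ Φ e ≤ 1 := by
  have h := hΦ e
  have h2 : ‖feature Φ e‖ ^ 2 = Φ e ⬝ᵥ Φ e := by
    rw [EuclideanSpace.real_norm_sq_eq]
    simp [feature, dotProduct, sq]
  rw [← h2]
  exact pow_le_one₀ (norm_nonneg _) h

/-- The determinant bound uses the variances under the initial `p`, not the intermediate ones. The
factor `1 + q_a/σ²` gained by processing `a` pays exactly for replacing the later variances by the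
initial ones. -/
theorem foldl_kalmanStep_snd (hΦ : ∀ e, ‖feature Φ e‖ ≤ 1) {σ : ℝ} (hσ : 0 < σ) (w : Fin L → ℝ)
    (l : List (Fin L)) (p : Belief d) (hp : p.2.PosDef) :
    let r := l.foldl (fun q e => kalmanStep σ (feature Φ e) (w e) q) p
    r.2.PosDef ∧ r.2⁻¹.trace ≤ p.2⁻¹.trace + l.length / σ ^ 2 ∧
      (∀ u, u ⬝ᵥ (r.2 *ᵥ u) ≤ u ⬝ᵥ (p.2 *ᵥ u)) ∧
      r.2.det * (1 + (l.map fun e => Φ e ⬝ᵥ (p.2 *ᵥ Φ e)).sum / σ ^ 2) ≤ p.2.det := by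
  induction l generalizing p with
  | nil => simpa using hp
  | cons a l ih =>
    have hp' : (kalmanStep σ (feature Φ a) (w a) p).2.PosDef := covStep_posDef hσ _ hp
    obtain ⟨h1, h2, h3, h4⟩ := ih _ hp'
    refine ⟨h1, ?_, fun u => (h3 u).trans (dotProduct_covStep_mulVec_le _ _ hp.posSemidef), ?_⟩
    · refine h2.trans ?_
      rw [kalmanStep_snd, trace_inv_covStep hσ _ hp]
      have := feature_dotProduct_self_le hΦ a
      have h5 : (feature Φ a).ofLp ⬝ᵥ (feature Φ a).ofLp / σ ^ 2 ≤ 1 / σ ^ 2 := by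
        gcongr
        exact this
      rw [List.length_cons]
      push_cast
      rw [add_div]
      linarith
    · rw [det_covStep hσ (Φ a) hp]
      have hq := dotProduct_mulVec_self_nonneg hp.posSemidef (Φ a)
      have hs : (l.map fun e => Φ e ⬝ᵥ (p.2 *ᵥ Φ e)).sum ≤ (1 + Φ a ⬝ᵥ (p.2 *ᵥ Φ a) / σ ^ 2)
          * (l.map fun e => Φ e ⬝ᵥ (covStep σ (Φ a) p.2 *ᵥ Φ e)).sum := by
        rw [← List.sum_map_mul_left]
        exact List.sum_le_sum fun e _ => dotProduct_mulVec_le_covStep hσ _ _ hp.posSemidef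
      refine le_trans ?_ (mul_le_mul_of_nonneg_right h4 (by positivity))
      rw [mul_assoc, List.map_cons, List.sum_cons]
      refine mul_le_mul_of_nonneg_left ?_ h1.det_pos.le
      change _ ≤ (1 + (l.map fun e => Φ e ⬝ᵥ (covStep σ (Φ a) p.2 *ᵥ Φ e)).sum / σ ^ 2) * _
      rw [add_div]
      have := div_le_div_of_nonneg_right hs (sq_nonneg σ)
      rw [mul_div_assoc] at this
      linarith

theorem kalmanFilter_snd (hΦ : ∀ e, ‖feature Φ e‖ ≤ 1) {σ : ℝ} (hσ : 0 < σ)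
    (A : Finset (Fin L)) (w : Fin L → ℝ) (p : Belief d) (hp : p.2.PosDef) :
    (kalmanFilter Φ σ A w p).2.PosDef ∧
      (kalmanFilter Φ σ A w p).2⁻¹.trace ≤ p.2⁻¹.trace + A.card / σ ^ 2 ∧
      (∀ u, u ⬝ᵥ ((kalmanFilter Φ σ A w p).2 *ᵥ u) ≤ u ⬝ᵥ (p.2 *ᵥ u)) ∧
      (kalmanFilter Φ σ A w p).2.det * (1 + (∑ e ∈ A, Φ e ⬝ᵥ (p.2 *ᵥ Φ e)) / σ ^ 2) ≤ p.2.det := by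
  have h := foldl_kalmanStep_snd hΦ hσ w (A.sort (· ≤ ·)) p hp
  have hs : ((A.sort (· ≤ ·)).map fun e => Φ e ⬝ᵥ (p.2 *ᵥ Φ e)).sum
      = ∑ e ∈ A, Φ e ⬝ᵥ (p.2 *ᵥ Φ e) := by
    rw [← List.sum_toFinset _ (A.sort_nodup _), Finset.sort_toFinset]
  rw [hs, Finset.length_sort] at h
  exact h

end Filter

/-! ### Elliptical potential -/

section Potential

open Matrix Real

/-- Every eigenvalue is at most the trace. This is cruder than the arithmetic-geometric mean bound,
but the loss is only an additive `d log d` in the logarithm. -/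
theorem det_le_trace_pow {d : ℕ} {P : Matrix (Fin d) (Fin d) ℝ} (hP : P.PosDef) :
    P.det ≤ P.trace ^ d := by
  rw [hP.1.det_eq_prod_eigenvalues, hP.1.trace_eq_sum_eigenvalues]
  have h (i : Fin d) : hP.1.eigenvalues i ≤ ∑ j, hP.1.eigenvalues j :=
    Finset.single_le_sum (fun j _ => (hP.eigenvalues_pos j).le) (Finset.mem_univ i)
  refine (Finset.prod_le_prod (fun j _ => (hP.eigenvalues_pos j).le) fun j _ => h j).trans ?_
  simp

/-- Concavity of the logarithm, here in the form of Bernoulli's inequality `(1 + x)^(u/x) ≤ 1 + u`.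
-/
theorem mul_log_one_add_le {u x : ℝ} (hu : 0 ≤ u) (hux : u ≤ x) (hx : 0 < x) :
    u / x * log (1 + x) ≤ log (1 + u) := by
  rw [← log_rpow (by linarith)]
  refine log_le_log (rpow_pos_of_pos (by linarith) _) ?_
  have h := rpow_one_add_le_one_add_mul_self (s := x) (by linarith) (div_nonneg hu hx.le)
    ((div_le_one hx).2 hux)
  rwa [div_mul_cancel₀ _ hx.ne'] at h

variable {L d : ℕ} {S : Type*} {Φ : Matrix (Fin L) (Fin d) ℝ} {lam σ : ℝ}
  {oracle : (Fin L → ℝ) → S → Finset (Fin L)} {K : ℕ}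

/-- The total posterior variance `∑_{e ∈ A} φ_eᵀ Σ φ_e` of the items of `A`. -/
noncomputable def totalVar (Φ : Matrix (Fin L) (Fin d) ℝ) (p : Belief d) (A : Finset (Fin L)) : ℝ :=
  ∑ e ∈ A, Φ e ⬝ᵥ (p.2 *ᵥ Φ e)

theorem belief_spec (hΦ : ∀ e, ‖feature Φ e‖ ≤ 1) (hσ : 0 < σ) (hlam : 0 < lam)
    (hK : ∀ w s, (oracle w s).card ≤ K) (ω : Sample L d S) (t : ℕ) :
    (belief Φ lam σ oracle t ω).2.PosDef ∧
      (belief Φ lam σ oracle t ω).2⁻¹.trace ≤ d / lam ^ 2 + t * (K / σ ^ 2) ∧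
      (∀ u, u ⬝ᵥ ((belief Φ lam σ oracle t ω).2 *ᵥ u) ≤ lam ^ 2 * (u ⬝ᵥ u)) ∧
      ∑ s ∈ Finset.range t, log (1 + totalVar Φ (belief Φ lam σ oracle s ω)
        (chosenSet Φ lam σ oracle s ω) / σ ^ 2) ≤
        d * log (lam ^ 2) - log (belief Φ lam σ oracle t ω).2.det := by
  induction t with
  | zero =>
    have hpd : (lam ^ 2 • (1 : Matrix (Fin d) (Fin d) ℝ)).PosDef :=
      PosDef.one.smul (by positivity)
    refine ⟨hpd, ?_, fun u => ?_, ?_⟩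
    · change (lam ^ 2 • (1 : Matrix (Fin d) (Fin d) ℝ))⁻¹.trace ≤ _
      have : (lam ^ 2 • (1 : Matrix (Fin d) (Fin d) ℝ))⁻¹
          = (lam ^ 2)⁻¹ • (1 : Matrix (Fin d) (Fin d) ℝ) := by
        apply inv_eq_left_inv
        rw [smul_mul_smul_comm, inv_mul_cancel₀ (by positivity), one_smul, mul_one]
      rw [this, trace_smul, trace_one]
      simp [div_eq_inv_mul]
    · change u ⬝ᵥ ((lam ^ 2 • (1 : Matrix (Fin d) (Fin d) ℝ)) *ᵥ u) ≤ _
      rw [smul_mulVec, one_mulVec, dotProduct_smul, smul_eq_mul]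
    · change _ ≤ _ - log (lam ^ 2 • (1 : Matrix (Fin d) (Fin d) ℝ)).det
      simp
  | succ t ih =>
    obtain ⟨h1, h2, h3, h4⟩ := ih
    obtain ⟨g1, g2, g3, g4⟩ := kalmanFilter_snd hΦ hσ (chosenSet Φ lam σ oracle t ω)
      (weight Φ t ω) _ h1
    refine ⟨g1, ?_, fun u => (g3 u).trans (h3 u), ?_⟩
    · refine g2.trans ?_
      have hc : ((chosenSet Φ lam σ oracle t ω).card : ℝ) ≤ K := by
        exact_mod_cast hK _ _
      have : ((chosenSet Φ lam σ oracle t ω).card : ℝ) / σ ^ 2 ≤ K / σ ^ 2 := by gcongr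
      push_cast
      linarith
    · rw [Finset.sum_range_succ]
      have hv : 0 ≤ totalVar Φ (belief Φ lam σ oracle t ω) (chosenSet Φ lam σ oracle t ω) :=
        Finset.sum_nonneg fun e _ => dotProduct_mulVec_self_nonneg h1.posSemidef _
      have hp : 0 < 1 + totalVar Φ (belief Φ lam σ oracle t ω) (chosenSet Φ lam σ oracle t ω)
          / σ ^ 2 := by positivity
      have := log_le_log (mul_pos g1.det_pos hp) g4
      rw [log_mul g1.det_pos.ne' hp.ne'] at this
      change log (belief Φ lam σ oracle (t + 1) ω).2.det + _ ≤ _ at this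
      linarith

theorem belief_posDef (hΦ : ∀ e, ‖feature Φ e‖ ≤ 1) (hσ : 0 < σ) (hlam : 0 < lam)
    (ω : Sample L d S) (t : ℕ) : (belief Φ lam σ oracle t ω).2.PosDef :=
  -- Any subset of the ground set has at most `L` elements, so no cardinality bound on the oracle is
  -- needed here.
  (belief_spec (K := L) hΦ hσ hlam (fun _ _ => (Finset.card_le_univ _).trans_eq (Fintype.card_fin L)) ω t).1

theorem totalVar_belief_nonneg (hΦ : ∀ e, ‖feature Φ e‖ ≤ 1) (hσ : 0 < σ) (hlam : 0 < lam)
    (ω : Sample L d S) (t : ℕ) (A : Finset (Fin L)) :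
    0 ≤ totalVar Φ (belief Φ lam σ oracle t ω) A :=
  Finset.sum_nonneg fun _ _ =>
    dotProduct_mulVec_self_nonneg (belief_posDef hΦ hσ hlam ω t).posSemidef _

theorem totalVar_belief_le (hΦ : ∀ e, ‖feature Φ e‖ ≤ 1) (hσ : 0 < σ) (hlam : 0 < lam)
    (hK : ∀ w s, (oracle w s).card ≤ K) (ω : Sample L d S) (t : ℕ) {A : Finset (Fin L)}
    (hA : A.card ≤ K) : totalVar Φ (belief Φ lam σ oracle t ω) A ≤ K * lam ^ 2 := by
  have h := (belief_spec hΦ hσ hlam hK ω t).2.2.1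
  calc totalVar Φ (belief Φ lam σ oracle t ω) A ≤ ∑ e ∈ A, lam ^ 2 := by
        refine Finset.sum_le_sum fun e _ => (h _).trans ?_
        exact mul_le_of_le_one_right (by positivity) (feature_dotProduct_self_le hΦ e)
    _ ≤ K * lam ^ 2 := by
        rw [Finset.sum_const, nsmul_eq_mul]
        gcongr

/-- The elliptical potential lemma, with the delay caused by the semi-bandit feedback. -/
theorem sum_totalVar_le (hΦ : ∀ e, ‖feature Φ e‖ ≤ 1) (hσ : 0 < σ) (hlam : σ ≤ lam)
    (hK : ∀ w s, (oracle w s).card ≤ K) (ω : Sample L d S) {n : ℕ} (hn : 1 ≤ n) (hK1 : 1 ≤ K)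
    (hd : 1 ≤ d) :
    ∑ t ∈ Finset.range n, totalVar Φ (belief Φ lam σ oracle t ω) (chosenSet Φ lam σ oracle t ω) ≤
      K * lam ^ 2 * d * (1 + log (n * d) / log 2) := by
  have hlam0 : 0 < lam := hσ.trans_le hlam
  obtain ⟨h1, h2, -, h4⟩ := belief_spec hΦ hσ hlam0 hK ω n
  set P := (belief Φ lam σ oracle n ω).2⁻¹ with hP
  have hPd : P.PosDef := h1.inv
  have hn' : (1 : ℝ) ≤ n := by exact_mod_cast hn
  have hK' : (1 : ℝ) ≤ K := by exact_mod_cast hK1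
  have hd' : (1 : ℝ) ≤ d := by exact_mod_cast hd
  -- The largest possible value of `totalVar/σ²`. The chord bound below costs a factor `1/log(1 +
  -- x)`, which cancels the `log(1 + x)` of the determinant bound; hence no `log(λ/σ)` survives. The
  -- assumption `σ ≤ λ` gives `x ≥ 1`, so `log(1 + x) ≥ log 2`.
  set x : ℝ := K * lam ^ 2 / σ ^ 2 with hx
  have hx1 : 1 ≤ x := by
    rw [hx, le_div_iff₀ (by positivity), one_mul]
    nlinarith [pow_le_pow_left₀ hσ.le hlam 2, sq_nonneg lam]
  have hl2 : log 2 ≤ log (1 + x) := log_le_log (by norm_num) (by linarith)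
  have hl2p : 0 < log 2 := log_pos (by norm_num)
  have hdet : -log (belief Φ lam σ oracle n ω).2.det ≤ d * log P.trace := by
    have : P.det = (belief Φ lam σ oracle n ω).2.det⁻¹ := by
      rw [hP, det_nonsing_inv, Ring.inverse_eq_inv']
    rw [← log_inv, ← this, ← log_pow]
    exact log_le_log hPd.det_pos (det_le_trace_pow hPd)
  have htr : 0 < P.trace := by
    have := Fin.pos_iff_nonempty.1 hd
    exact hPd.trace_pos
  have hlog : d * log (lam ^ 2) + d * log P.trace ≤ d * (log (n * d) + log (1 + x)) := by
    rw [← mul_add, ← log_mul (by positivity) htr.ne', ← log_mul (by positivity) (by positivity)]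
    refine mul_le_mul_of_nonneg_left (log_le_log (by positivity) ?_) (by positivity)
    calc lam ^ 2 * P.trace ≤ lam ^ 2 * (d / lam ^ 2 + n * (K / σ ^ 2)) := by gcongr
      _ = d + n * x := by rw [hx]; field_simp
      _ ≤ n * d * (1 + x) := by
        have := mul_le_mul hn' hd' zero_le_one (by linarith)
        nlinarith [mul_nonneg (sub_nonneg.2 hn') (sub_nonneg.2 hd'),
          mul_le_mul_of_nonneg_left hd' (show 0 ≤ n * x by positivity)]
  have hstep (t : ℕ) : totalVar Φ (belief Φ lam σ oracle t ω) (chosenSet Φ lam σ oracle t ω)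
      ≤ K * lam ^ 2 / log (1 + x) * log (1 + totalVar Φ (belief Φ lam σ oracle t ω)
        (chosenSet Φ lam σ oracle t ω) / σ ^ 2) := by
    have ha : 0 ≤ totalVar Φ (belief Φ lam σ oracle t ω) (chosenSet Φ lam σ oracle t ω) :=
      totalVar_belief_nonneg hΦ hσ hlam0 ω t _
    have hc : (chosenSet Φ lam σ oracle t ω).card ≤ K := hK _ _
    have hb := totalVar_belief_le hΦ hσ hlam0 hK ω t hc
    generalize totalVar Φ (belief Φ lam σ oracle t ω) (chosenSet Φ lam σ oracle t ω) = v at ha hb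
    have := mul_log_one_add_le (u := v / σ ^ 2) (x := x) (by positivity)
      (by rw [hx]; gcongr) (by linarith)
    rw [div_mul_eq_mul_div, le_div_iff₀ (by linarith)]
    have hxv : v / σ ^ 2 / x = v / (K * lam ^ 2) := by rw [hx]; field_simp
    rw [hxv, div_mul_eq_mul_div, div_le_iff₀ (by positivity)] at this
    linarith
  calc _ ≤ ∑ t ∈ Finset.range n, K * lam ^ 2 / log (1 + x) * log (1 + totalVar Φ
        (belief Φ lam σ oracle t ω) (chosenSet Φ lam σ oracle t ω) / σ ^ 2) :=
        Finset.sum_le_sum fun t _ => hstep t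
    _ ≤ K * lam ^ 2 / log (1 + x) * (d * (log (n * d) + log (1 + x))) := by
        rw [← Finset.mul_sum]
        refine mul_le_mul_of_nonneg_left (by linarith) ?_
        exact div_nonneg (by positivity) (by linarith)
    _ = K * lam ^ 2 * d * (1 + log (n * d) / log (1 + x)) := by
        have : log (1 + x) ≠ 0 := by linarith
        field_simp
        ring
    _ ≤ _ := by
        have : 0 ≤ log (n * d : ℝ) := log_nonneg (one_le_mul_of_one_le_of_one_le hn' hd')
        gcongr

end Potential

/-! ### Measurability of the protocol -/

section Measurability

open Matrix

instance instMeasurableSpaceMatrix (d : ℕ) : MeasurableSpace (Matrix (Fin d) (Fin d) ℝ) :=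
  inferInstanceAs (MeasurableSpace (Fin d → Fin d → ℝ))

instance instBorelSpaceMatrix (d : ℕ) : BorelSpace (Matrix (Fin d) (Fin d) ℝ) :=
  inferInstanceAs (BorelSpace (Fin d → Fin d → ℝ))

variable {α : Type*} [MeasurableSpace α] {d : ℕ}

theorem measurable_matrix_iff {f : α → Matrix (Fin d) (Fin d) ℝ} :
    Measurable f ↔ ∀ i j, Measurable fun x => f x i j := by
  rw [show Measurable f ↔ Measurable (fun x i j => f x i j : α → Fin d → Fin d → ℝ) from Iff.rfl]
  simp only [measurable_pi_iff]

theorem _root_.Measurable.matrix_entry {f : α → Matrix (Fin d) (Fin d) ℝ} (hf : Measurable f)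
    (i j : Fin d) : Measurable fun x => f x i j :=
  measurable_matrix_iff.1 hf i j

theorem _root_.Measurable.matrix_mul {f g : α → Matrix (Fin d) (Fin d) ℝ} (hf : Measurable f)
    (hg : Measurable g) : Measurable fun x => f x * g x := by
  rw [measurable_matrix_iff]
  intro i j
  simp only [mul_apply]
  exact Finset.measurable_sum _ fun k _ => (hf.matrix_entry i k).mul (hg.matrix_entry k j)

theorem _root_.Measurable.matrix_sub {f g : α → Matrix (Fin d) (Fin d) ℝ} (hf : Measurable f)
    (hg : Measurable g) : Measurable fun x => f x - g x := by
  rw [measurable_matrix_iff]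
  exact fun i j => (hf.matrix_entry i j).sub (hg.matrix_entry i j)

theorem _root_.Measurable.matrix_smul {c : α → ℝ} {g : α → Matrix (Fin d) (Fin d) ℝ}
    (hc : Measurable c) (hg : Measurable g) : Measurable fun x => c x • g x := by
  rw [measurable_matrix_iff]
  exact fun i j => hc.mul (hg.matrix_entry i j)

theorem _root_.Measurable.mulVec {f : α → Matrix (Fin d) (Fin d) ℝ} {v : α → Fin d → ℝ}
    (hf : Measurable f) (hv : Measurable v) : Measurable fun x => f x *ᵥ v x := by
  rw [measurable_pi_iff]
  intro i
  simp only [Matrix.mulVec, dotProduct]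
  exact Finset.measurable_sum _ fun k _ => (hf.matrix_entry i k).mul (measurable_pi_iff.1 hv k)

theorem _root_.Measurable.dotProduct {u v : α → Fin d → ℝ}
    (hu : Measurable u) (hv : Measurable v) : Measurable fun x => u x ⬝ᵥ v x := by
  simp only [_root_.dotProduct]
  exact Finset.measurable_sum _ fun k _ =>
    (measurable_pi_iff.1 hu k).mul (measurable_pi_iff.1 hv k)

theorem measurable_kalmanStep (σ : ℝ) (φ : Param d) :
    Measurable fun q : ℝ × Belief d => kalmanStep σ φ q.1 q.2 := by
  have hM : Measurable fun q : ℝ × Belief d => q.2.2 := by fun_prop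
  have hm : Measurable fun q : ℝ × Belief d => q.2.1.ofLp := by fun_prop
  have hv := hM.mulVec (measurable_const (a := φ.ofLp))
  have hs : Measurable fun q : ℝ × Belief d => (φ.ofLp ⬝ᵥ (q.2.2 *ᵥ φ.ofLp) + σ ^ 2)⁻¹ :=
    ((measurable_const.dotProduct hv).add_const _).inv
  have hF := hM.matrix_mul (measurable_const (a := vecMulVec φ.ofLp φ.ofLp))
  unfold kalmanStep
  refine Measurable.prodMk ((WithLp.measurable_toLp 2 _).comp ?_)
    (hM.matrix_sub (hs.matrix_smul (hF.matrix_mul hM)))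
  exact ((measurable_const.matrix_sub (hs.matrix_smul hF)).mulVec hm).add
    (measurable_fst.smul (hs.smul hv))

open scoped Matrix.Norms.L2Operator in
theorem continuousOn_matrix_sqrt (d : ℕ) :
    ContinuousOn (CFC.sqrt : Matrix (Fin d) (Fin d) ℝ → _) {M | 0 ≤ M} :=
  CFC.continuousOn_sqrt

theorem isClosed_setOf_matrix_nonneg (d : ℕ) :
    IsClosed {M : Matrix (Fin d) (Fin d) ℝ | 0 ≤ M} := by
  have h : {M : Matrix (Fin d) (Fin d) ℝ | 0 ≤ M} = {M | Mᵀ = M} ∩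
      ⋂ v : Fin d → ℝ, {M | 0 ≤ v ⬝ᵥ (M *ᵥ v)} := by
    ext M
    rw [Set.mem_ofPred_eq, nonneg_iff_posSemidef, posSemidef_iff_dotProduct_mulVec]
    simp [IsHermitian, conjTranspose_eq_transpose_of_trivial]
  rw [h]
  refine (isClosed_eq (by fun_prop) continuous_id).inter (isClosed_iInter fun v => ?_)
  exact isClosed_le continuous_const (by fun_prop)

/-- The square root is continuous on the closed cone of positive semidefinite matrices, and off it
the functional calculus takes the default value `0`. -/
theorem measurable_matrix_sqrt (d : ℕ) :
    Measurable (CFC.sqrt : Matrix (Fin d) (Fin d) ℝ → _) := by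
  classical
  have h := (continuousOn_matrix_sqrt d).measurable_piecewise
    (continuousOn_const (c := (0 : Matrix (Fin d) (Fin d) ℝ)))
    (isClosed_setOf_matrix_nonneg d).measurableSet
  convert h using 1
  ext1 M
  by_cases hM : 0 ≤ M
  · exact (Set.piecewise_eq_of_mem {M : Matrix (Fin d) (Fin d) ℝ | 0 ≤ M} _ _ hM).symm
  · have h0 : CFC.sqrt M = 0 := by rw [CFC.sqrt, cfcₙ_apply_of_not_predicate _ hM]
    rw [h0]
    exact (Set.piecewise_eq_of_notMem {M : Matrix (Fin d) (Fin d) ℝ | 0 ≤ M} CFC.sqrt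
      (fun _ => 0) hM).symm

theorem measurable_gaussianSample :
    Measurable fun q : Belief d × Param d => gaussianSample q.1 q.2 := by
  have h1 : Measurable fun q : Belief d × Param d => CFC.sqrt q.1.2 :=
    (measurable_matrix_sqrt d).comp (by fun_prop)
  have h2 := h1.mulVec (v := fun q : Belief d × Param d => q.2.ofLp) (by fun_prop)
  have h3 : Measurable fun q : Belief d × Param d => q.1.1 := by fun_prop
  exact h3.add ((WithLp.measurable_toLp 2 _).comp h2)

variable {L : ℕ} {S : Type*} (Φ : Matrix (Fin L) (Fin d) ℝ)

theorem measurable_linWeight : Measurable (linWeight Φ) := by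
  unfold linWeight
  have : Continuous fun θ : Param d => Φ *ᵥ θ.ofLp := by fun_prop
  exact this.measurable

theorem measurable_foldl_kalmanStep (σ : ℝ) (l : List (Fin L)) :
    Measurable fun q : (Fin L → ℝ) × Belief d =>
      l.foldl (fun r e => kalmanStep σ (feature Φ e) (q.1 e) r) q.2 := by
  induction l with
  | nil => exact measurable_snd
  | cons a l ih =>
    exact ih.comp (measurable_fst.prodMk ((measurable_kalmanStep σ (feature Φ a)).comp
      (((measurable_pi_apply a).comp measurable_fst).prodMk measurable_snd)))

theorem measurable_kalmanFilter (σ : ℝ) :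
    Measurable fun q : Finset (Fin L) × (Fin L → ℝ) × Belief d =>
      kalmanFilter Φ σ q.1 q.2.1 q.2.2 :=
  measurable_from_prod_countable_right fun A =>
    measurable_foldl_kalmanStep Φ σ (A.sort (· ≤ ·))

theorem measurable_totalVar :
    Measurable fun q : Belief d × Finset (Fin L) => totalVar Φ q.1 q.2 :=
  measurable_from_prod_countable_left fun _ => Finset.measurable_sum _ fun _ _ =>
    measurable_const.dotProduct (measurable_snd.mulVec measurable_const)

theorem measurable_setReturn :
    Measurable fun q : Finset (Fin L) × (Fin L → ℝ) => setReturn q.1 q.2 :=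
  measurable_from_prod_countable_right fun _ => Finset.measurable_sum _ fun e _ =>
    measurable_pi_apply e

variable {Φ} [MeasurableSpace S] {lam σ : ℝ} {oracle : (Fin L → ℝ) → S → Finset (Fin L)}

theorem measurable_oracle
    (hmeas : ∀ A, MeasurableSet {q : (Fin L → ℝ) × S | oracle q.1 q.2 = A}) :
    Measurable fun q : (Fin L → ℝ) × S => oracle q.1 q.2 :=
  measurable_to_countable' hmeas

theorem measurable_oracle_gaussianSample
    (hmeas : ∀ A, MeasurableSet {q : (Fin L → ℝ) × S | oracle q.1 q.2 = A}) :
    Measurable fun q : Belief d × Param d × S =>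
      oracle (linWeight Φ (gaussianSample q.1 q.2.1)) q.2.2 :=
  (measurable_oracle hmeas).comp (((measurable_linWeight Φ).comp
    (measurable_gaussianSample.comp (measurable_fst.prodMk measurable_snd.fst))).prodMk
      measurable_snd.snd)

theorem measurable_chooseSet
    (hmeas : ∀ A, MeasurableSet {q : (Fin L → ℝ) × S | oracle q.1 q.2 = A}) :
    Measurable fun q : Belief d × EpisodeNoise L d S => chooseSet Φ oracle q.1 q.2 := by
  have h : Measurable fun q : Belief d × EpisodeNoise L d S => (q.1, q.2.1, q.2.2.1) := by fun_prop
  have h' := (measurable_oracle_gaussianSample (Φ := Φ) hmeas).comp h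
  unfold chooseSet
  exact h'

theorem measurable_weight (t : ℕ) :
    Measurable fun ω : Sample L d S => weight Φ t ω := by
  have h : Measurable fun ω : Sample L d S => (ω.2.2 t).2.2 :=
    ((measurable_pi_apply t).comp measurable_snd.snd).snd.snd
  exact ((measurable_linWeight Φ).comp measurable_fst).add h

theorem measurable_belief
    (hmeas : ∀ A, MeasurableSet {q : (Fin L → ℝ) × S | oracle q.1 q.2 = A}) (t : ℕ) :
    Measurable fun ω : Sample L d S => belief Φ lam σ oracle t ω := by
  induction t with
  | zero => exact measurable_const
  | succ t ih =>
    exact (measurable_kalmanFilter Φ σ).comp (((measurable_chooseSet hmeas).comp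
      (ih.prodMk ((measurable_pi_apply t).comp measurable_snd.snd))).prodMk
        ((measurable_weight t).prodMk ih))

theorem measurable_chosenSet
    (hmeas : ∀ A, MeasurableSet {q : (Fin L → ℝ) × S | oracle q.1 q.2 = A}) (t : ℕ) :
    Measurable fun ω : Sample L d S => chosenSet Φ lam σ oracle t ω := by
  have h : Measurable fun ω : Sample L d S => (belief Φ lam σ oracle t ω, ω.2.2 t) :=
    (measurable_belief hmeas t).prodMk ((measurable_pi_apply t).comp measurable_snd.snd)
  have h' := (measurable_chooseSet (Φ := Φ) hmeas).comp h
  unfold chosenSet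
  exact h'

theorem measurable_refSet
    (hmeas : ∀ A, MeasurableSet {q : (Fin L → ℝ) × S | oracle q.1 q.2 = A}) :
    Measurable fun ω : Sample L d S => refSet Φ oracle ω := by
  have h : Measurable fun ω : Sample L d S => (linWeight Φ ω.1, ω.2.1) :=
    ((measurable_linWeight Φ).comp measurable_fst).prodMk measurable_snd.fst
  have h' := (measurable_oracle hmeas).comp h
  unfold refSet
  exact h'

end Measurability

/-! ### Resampling one coordinate of a product measure -/

section Resampling

open scoped ENNReal

variable {ι : Type*} [DecidableEq ι] {X : ι → Type*} [∀ i, MeasurableSpace (X i)]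
  (μ : ∀ i, Measure (X i)) [∀ i, IsProbabilityMeasure (μ i)]

theorem map_update_infinitePi (i : ι) :
    ((Measure.infinitePi μ).prod (μ i)).map (fun q => Function.update q.1 i q.2)
      = Measure.infinitePi μ := by
  classical
  refine Measure.eq_infinitePi μ fun s t ht => ?_
  have hm : Measurable fun q : (∀ j, X j) × X i => Function.update q.1 i q.2 :=
    measurable_update'
  rw [Measure.map_apply hm (MeasurableSet.pi s.countable_toSet fun j _ => ht j)]
  have : (fun q : (∀ j, X j) × X i => Function.update q.1 i q.2) ⁻¹' (s : Set ι).pi t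
      = ((s.erase i : Finset ι) : Set ι).pi t ×ˢ (if i ∈ s then t i else Set.univ) := by
    ext ⟨ξ, x⟩
    simp only [Set.mem_preimage, Set.mem_pi, Set.mem_prod, Finset.mem_coe, Finset.mem_erase]
    constructor
    · intro h
      refine ⟨fun j hj => by simpa [hj.1] using h j hj.2, ?_⟩
      split_ifs with hi
      · simpa using h i hi
      · trivial
    · rintro ⟨h1, h2⟩ j hj
      rcases eq_or_ne j i with rfl | hne
      · simpa [hj] using h2
      · simpa [hne] using h1 j ⟨hne, hj⟩
  rw [this, Measure.prod_prod, Measure.infinitePi_pi _ fun j _ => ht j]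
  split_ifs with hi
  · exact Finset.prod_erase_mul s (fun j => μ j (t j)) hi
  · rw [measure_univ, mul_one, Finset.erase_eq_of_notMem hi]

/-- Replaces conditioning on the other coordinates: one coordinate becomes an explicit fresh
variable. It is used both for the episodes and for the noises of the items within an episode. -/
theorem lintegral_infinitePi_update (i : ι) {f : (∀ j, X j) → ℝ≥0∞} (hf : Measurable f) :
    ∫⁻ ξ, f ξ ∂Measure.infinitePi μ
      = ∫⁻ ξ, ∫⁻ x, f (Function.update ξ i x) ∂μ i ∂Measure.infinitePi μ := by
  have hm : Measurable fun q : (∀ j, X j) × X i => Function.update q.1 i q.2 :=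
    measurable_update'
  conv_lhs => rw [← map_update_infinitePi μ i]
  rw [lintegral_map hf hm]
  exact lintegral_prod _ (hf.comp hm).aemeasurable

end Resampling

/-! ### Conjugacy of the Kalman update -/

section GaussianUpdate

open Matrix
open scoped ENNReal

variable {d : ℕ}

/-- The Kalman gain. -/
noncomputable def kalmanGain (σ : ℝ) (φ : Param d) (M : Matrix (Fin d) (Fin d) ℝ) : Param d :=
  WithLp.toLp 2 ((φ.ofLp ⬝ᵥ (M *ᵥ φ.ofLp) + σ ^ 2)⁻¹ • (M *ᵥ φ.ofLp))

theorem kalmanStep_fst (σ : ℝ) (φ : Param d) (w : ℝ) (p : Belief d) :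
    (kalmanStep σ φ w p).1 = p.1 + (w - φ.ofLp ⬝ᵥ p.1.ofLp) • kalmanGain σ φ p.2 := by
  ext i
  simp only [kalmanStep, kalmanGain, sub_mulVec, one_mulVec, smul_mulVec, ← mulVec_mulVec,
    vecMulVec_mulVec, op_smul_eq_smul, mulVec_smul, PiLp.add_apply, PiLp.smul_apply, Pi.add_apply,
    Pi.sub_apply, Pi.smul_apply, smul_eq_mul]
  ring

theorem inner_eq_dotProduct (x y : Param d) : inner ℝ x y = x.ofLp ⬝ᵥ y.ofLp := by
  rw [EuclideanSpace.inner_eq_star_dotProduct, dotProduct_comm]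
  simp

theorem gaussianSample_eq_add (p : Belief d) (z : Param d) :
    gaussianSample p z = p.1 + gaussianSample (0, p.2) z := by
  simp [gaussianSample]

theorem dual_real_prod_param (Λ : StrongDual ℝ (ℝ × Param d)) :
    ∃ (s : ℝ) (a : Param d), ∀ w u, Λ (w, u) = w * s + inner ℝ u a := by
  refine ⟨Λ (1, 0), (InnerProductSpace.toDual ℝ (Param d)).symm
    (Λ.comp (ContinuousLinearMap.inr ℝ ℝ (Param d))), fun w u => ?_⟩
  rw [real_inner_comm, InnerProductSpace.toDual_symm_apply]
  have : ((w, u) : ℝ × Param d) = w • (1, 0) + (0, u) := by simp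
  rw [this, map_add, map_smul]
  simp

/-- The conjugacy of Gaussian priors and Gaussian observations: given the observation
`w = φᵀ θ + x`, the conditional law of `θ` is the Gaussian given by the Kalman update. -/
theorem map_observation {σ : ℝ} (hσ : 0 < σ) (φ : Param d) (p : Belief d) (hp : p.2.PosDef) :
    ((gaussianReal 0 (Real.toNNReal (σ ^ 2))).prod (multivariateGaussian p.1 p.2)).map
        (fun q => (φ.ofLp ⬝ᵥ q.2.ofLp + q.1, q.2))
      = (((gaussianReal 0 (Real.toNNReal (σ ^ 2))).prod (multivariateGaussian p.1 p.2)).prod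
          (multivariateGaussian 0 (covStep σ φ.ofLp p.2))).map
        (fun q => (φ.ofLp ⬝ᵥ q.1.2.ofLp + q.1.1,
          (kalmanStep σ φ (φ.ofLp ⬝ᵥ q.1.2.ofLp + q.1.1) p).1 + q.2)) := by
  have hw : Measurable fun q : ℝ × Param d => φ.ofLp ⬝ᵥ q.2.ofLp + q.1 := by
    have : Continuous fun q : ℝ × Param d => φ.ofLp ⬝ᵥ q.2.ofLp + q.1 := by fun_prop
    exact this.measurable
  have hm1 : Measurable fun q : ℝ × Param d => (φ.ofLp ⬝ᵥ q.2.ofLp + q.1, q.2) :=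
    hw.prodMk measurable_snd
  have hm2 : Measurable fun q : (ℝ × Param d) × Param d => (φ.ofLp ⬝ᵥ q.1.2.ofLp + q.1.1,
      (kalmanStep σ φ (φ.ofLp ⬝ᵥ q.1.2.ofLp + q.1.1) p).1 + q.2) := by
    simp only [kalmanStep_fst]
    have : Continuous fun q : (ℝ × Param d) × Param d => (φ.ofLp ⬝ᵥ q.1.2.ofLp + q.1.1,
      p.1 + (φ.ofLp ⬝ᵥ q.1.2.ofLp + q.1.1 - φ.ofLp ⬝ᵥ p.1.ofLp) • kalmanGain σ φ p.2 + q.2) := by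
      fun_prop
    exact this.measurable
  have : IsProbabilityMeasure (((gaussianReal 0 (Real.toNNReal (σ ^ 2))).prod
      (multivariateGaussian p.1 p.2)).map (fun q => (φ.ofLp ⬝ᵥ q.2.ofLp + q.1, q.2))) :=
    Measure.isProbabilityMeasure_map hm1.aemeasurable
  have : IsProbabilityMeasure ((((gaussianReal 0 (Real.toNNReal (σ ^ 2))).prod
      (multivariateGaussian p.1 p.2)).prod
          (multivariateGaussian 0 (covStep σ φ.ofLp p.2))).map
        (fun q => (φ.ofLp ⬝ᵥ q.1.2.ofLp + q.1.1,
          (kalmanStep σ φ (φ.ofLp ⬝ᵥ q.1.2.ofLp + q.1.1) p).1 + q.2))) :=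
    Measure.isProbabilityMeasure_map hm2.aemeasurable
  -- Both laws are images of independent Gaussians under affine maps, so their characteristic
  -- functions are explicit and only the exponents have to be compared.
  apply Measure.ext_of_charFunDual
  ext Λ
  obtain ⟨s, a, hΛ⟩ := dual_real_prod_param Λ
  have hΛm : Continuous fun v : ℝ × Param d => Complex.exp (Λ v * Complex.I) := by fun_prop
  rw [charFunDual_apply, charFunDual_apply,
    integral_map hm1.aemeasurable hΛm.aestronglyMeasurable,
    integral_map hm2.aemeasurable hΛm.aestronglyMeasurable]
  set k := kalmanGain σ φ p.2 with hk
  have e1 (q : ℝ × Param d) : Complex.exp (Λ (φ.ofLp ⬝ᵥ q.2.ofLp + q.1, q.2) * Complex.I)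
      = Complex.exp (s * q.1 * Complex.I) * Complex.exp (inner ℝ q.2 (s • φ + a) * Complex.I) := by
    rw [hΛ, ← Complex.exp_add, ← inner_eq_dotProduct, inner_add_right, inner_smul_right,
      real_inner_comm φ]
    congr 1
    push_cast
    ring
  have e2 (q : (ℝ × Param d) × Param d) :
      Complex.exp (Λ (φ.ofLp ⬝ᵥ q.1.2.ofLp + q.1.1,
          (kalmanStep σ φ (φ.ofLp ⬝ᵥ q.1.2.ofLp + q.1.1) p).1 + q.2) * Complex.I)
      = (Complex.exp ((s + inner ℝ k a : ℝ) * q.1.1 * Complex.I)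
          * (Complex.exp (inner ℝ q.1.2 ((s + inner ℝ k a) • φ) * Complex.I)
          * Complex.exp ((inner ℝ p.1 a - inner ℝ φ p.1 * inner ℝ k a) * Complex.I)))
        * Complex.exp (inner ℝ q.2 a * Complex.I) := by
    rw [hΛ, ← Complex.exp_add, ← Complex.exp_add, ← Complex.exp_add, kalmanStep_fst, ← hk,
      ← inner_eq_dotProduct, ← inner_eq_dotProduct, inner_add_left, inner_add_left,
      inner_smul_left, inner_smul_right, real_inner_comm φ]
    congr 1
    simp only [conj_trivial]
    push_cast
    ring
  simp_rw [e1, e2]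
  rw [integral_prod_mul (fun x : ℝ => Complex.exp (s * x * Complex.I))
      (fun y : Param d => Complex.exp (inner ℝ y (s • φ + a) * Complex.I)),
    integral_prod_mul (fun q : ℝ × Param d =>
      Complex.exp ((s + inner ℝ k a : ℝ) * q.1 * Complex.I)
          * (Complex.exp (inner ℝ q.2 ((s + inner ℝ k a) • φ) * Complex.I)
          * Complex.exp ((inner ℝ p.1 a - inner ℝ φ p.1 * inner ℝ k a) * Complex.I)))
      (fun y : Param d => Complex.exp (inner ℝ y a * Complex.I)),
    integral_prod_mul (fun x : ℝ => Complex.exp ((s + inner ℝ k a : ℝ) * x * Complex.I))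
      (fun y : Param d => Complex.exp (inner ℝ y ((s + inner ℝ k a) • φ) * Complex.I)
          * Complex.exp ((inner ℝ p.1 a - inner ℝ φ p.1 * inner ℝ k a) * Complex.I)),
    integral_mul_const, ← charFun_apply, ← charFun_apply, ← charFun_apply, ← charFun_apply_real,
    ← charFun_apply_real, charFun_gaussianReal, charFun_gaussianReal,
    charFun_multivariateGaussian hp.posSemidef, charFun_multivariateGaussian hp.posSemidef,
    charFun_multivariateGaussian (covStep_posDef hσ _ hp).posSemidef,
    dotProduct_covStep_mulVec _ _ _ hp.1]
  simp only [← Complex.exp_add]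
  congr 1
  -- On the right, `s` is shifted by `⟨k, a⟩ = r/(q + σ²)`. Expanding `(s + ⟨k, a⟩)² (q + σ²)`
  -- creates the extra term `r²/(q + σ²)`, which cancels the reduction of the variance of `a` in
  -- `covStep`.
  have hka : inner ℝ k a = φ.ofLp ⬝ᵥ (p.2 *ᵥ a.ofLp) / (φ.ofLp ⬝ᵥ (p.2 *ᵥ φ.ofLp) + σ ^ 2) := by
    rw [inner_eq_dotProduct, hk, kalmanGain, smul_dotProduct, smul_eq_mul, div_eq_inv_mul,
      dotProduct_comm _ a.ofLp, dotProduct_mulVec_comm_of_isHermitian hp.1 a.ofLp]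
  have hq := dotProduct_mulVec_self_nonneg hp.posSemidef φ.ofLp
  have hsym := dotProduct_mulVec_comm_of_isHermitian hp.1 a.ofLp φ.ofLp
  simp only [WithLp.ofLp_add, WithLp.ofLp_smul, mulVec_add, mulVec_smul,
    dotProduct_add, add_dotProduct, dotProduct_smul, smul_dotProduct, smul_eq_mul, hsym,
    inner_add_left, inner_smul_left, inner_zero_right, conj_trivial,
    Real.coe_toNNReal _ (sq_nonneg σ), hka]
  rw [real_inner_comm p.1 a]
  generalize φ.ofLp ⬝ᵥ (p.2 *ᵥ φ.ofLp) = q at *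
  generalize φ.ofLp ⬝ᵥ (p.2 *ᵥ a.ofLp) = r at *
  generalize a.ofLp ⬝ᵥ (p.2 *ᵥ a.ofLp) = t at *
  have hne : ((q : ℂ) + σ ^ 2) ≠ 0 := by
    have : q + σ ^ 2 ≠ 0 := by positivity
    exact_mod_cast this
  push_cast
  field_simp
  ring

end GaussianUpdate

/-! ### Posterior after one episode with a fixed observed set -/

section Posterior

open Matrix
open scoped ENNReal

attribute [local irreducible] kalmanStep gaussianSample kalmanFilter

variable {d : ℕ}

/-- The mean of `F (p, θ)` for `θ ∼ N(p.1, p.2)`. -/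
noncomputable def posteriorMean (F : Belief d × Param d → ℝ≥0∞) (p : Belief d) : ℝ≥0∞ :=
  ∫⁻ z, F (p, gaussianSample p z) ∂stdGaussian (Param d)

theorem measurable_posteriorMean {F : Belief d × Param d → ℝ≥0∞} (hF : Measurable F) :
    Measurable (posteriorMean F) :=
  Measurable.lintegral_prod_right'
    (hF.comp (measurable_fst.prodMk measurable_gaussianSample))

theorem measurable_gaussianSample_right (p : Belief d) : Measurable (gaussianSample p) :=
  measurable_gaussianSample.comp measurable_prodMk_left

theorem lintegral_multivariateGaussian (p : Belief d) {f : Param d → ℝ≥0∞} (hf : Measurable f) :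
    ∫⁻ θ, f θ ∂multivariateGaussian p.1 p.2
      = ∫⁻ z, f (gaussianSample p z) ∂stdGaussian (Param d) := by
  rw [← map_gaussianSample, lintegral_map hf (measurable_gaussianSample_right p)]

/-- Tower property for a single observation: the true parameter may be redrawn from the updated
belief. Nonnegative test functions keep integrability out of the induction. -/
theorem lintegral_kalmanStep {σ : ℝ} (hσ : 0 < σ) (φ : Param d) (p : Belief d) (hp : p.2.PosDef)
    {F : Belief d × Param d → ℝ≥0∞} (hF : Measurable F) :
    ∫⁻ x, ∫⁻ z, F (kalmanStep σ φ (φ.ofLp ⬝ᵥ (gaussianSample p z).ofLp + x) p, gaussianSample p z)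
        ∂stdGaussian (Param d) ∂gaussianReal 0 (Real.toNNReal (σ ^ 2))
      = ∫⁻ x, ∫⁻ z, posteriorMean F (kalmanStep σ φ (φ.ofLp ⬝ᵥ (gaussianSample p z).ofLp + x) p)
        ∂stdGaussian (Param d) ∂gaussianReal 0 (Real.toNNReal (σ ^ 2)) := by
  have hw : Measurable fun q : ℝ × Param d => φ.ofLp ⬝ᵥ q.2.ofLp + q.1 := by
    have : Continuous fun q : ℝ × Param d => φ.ofLp ⬝ᵥ q.2.ofLp + q.1 := by fun_prop
    exact this.measurable
  have hm1 : Measurable fun q : ℝ × Param d => (φ.ofLp ⬝ᵥ q.2.ofLp + q.1, q.2) :=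
    hw.prodMk measurable_snd
  have hk : Measurable fun w : ℝ => kalmanStep σ φ w p :=
    (measurable_kalmanStep σ φ).comp measurable_prodMk_right
  have hkw : Measurable fun q : ℝ × Param d => kalmanStep σ φ (φ.ofLp ⬝ᵥ q.2.ofLp + q.1) p :=
    hk.comp hw
  have hm2 : Measurable fun q : (ℝ × Param d) × Param d => (φ.ofLp ⬝ᵥ q.1.2.ofLp + q.1.1,
      (kalmanStep σ φ (φ.ofLp ⬝ᵥ q.1.2.ofLp + q.1.1) p).1 + q.2) :=
    (hw.comp measurable_fst).prodMk ((hkw.comp measurable_fst).fst.add measurable_snd)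
  have hG : Measurable fun v : ℝ × Param d => F (kalmanStep σ φ v.1 p, v.2) :=
    hF.comp ((hk.comp measurable_fst).prodMk measurable_snd)
  have h := congrArg (fun M => ∫⁻ v, F (kalmanStep σ φ v.1 p, v.2) ∂M) (map_observation hσ φ p hp)
  simp only at h
  rw [lintegral_map hG hm1, lintegral_map hG hm2] at h
  have hG1 := hG.comp hm1
  have hG2 := hG.comp hm2
  have l1 := lintegral_prod (μ := gaussianReal 0 (Real.toNNReal (σ ^ 2)))
    (ν := multivariateGaussian p.1 p.2) _ hG1.aemeasurable
  have l2 := lintegral_prod (μ := (gaussianReal 0 (Real.toNNReal (σ ^ 2))).prod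
    (multivariateGaussian p.1 p.2)) (ν := multivariateGaussian 0 (covStep σ φ.ofLp p.2)) _
    hG2.aemeasurable
  have l3 := lintegral_prod (μ := gaussianReal 0 (Real.toNNReal (σ ^ 2)))
    (ν := multivariateGaussian p.1 p.2) _
    (hG2.lintegral_prod_right' (ν := multivariateGaussian 0 (covStep σ φ.ofLp p.2))).aemeasurable
  simp only [Function.comp_def] at l1 l2 l3
  rw [l1, l2, l3] at h
  convert h using 3 with x x
  · exact (lintegral_multivariateGaussian p (hG1.comp (measurable_prodMk_left (x := x)))).symm
  · refine Eq.trans ?_ (lintegral_multivariateGaussian p ((hG2.lintegral_prod_right'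
      (ν := multivariateGaussian 0 (covStep σ φ.ofLp p.2))).comp
        (measurable_prodMk_left (x := x)))).symm
    refine lintegral_congr fun z => ?_
    rw [posteriorMean]
    have l4 := lintegral_multivariateGaussian ((0 : Param d), covStep σ φ.ofLp p.2)
      (hG2.comp (measurable_prodMk_left (x := (x, gaussianSample p z))))
    refine Eq.trans ?_ l4.symm
    refine lintegral_congr fun z' => ?_
    simp only [Function.comp_apply]
    rw [gaussianSample_eq_add (kalmanStep _ _ _ _), kalmanStep_snd]

variable {L : ℕ} (Φ : Matrix (Fin L) (Fin d) ℝ)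

/-- The law of the noise vector of an episode. -/
noncomputable abbrev noiseLaw (L : ℕ) (σ : ℝ) : Measure (Fin L → ℝ) :=
  Measure.pi fun _ : Fin L => gaussianReal 0 (Real.toNNReal (σ ^ 2))

theorem lintegral_noiseLaw_update (σ : ℝ) (a : Fin L) {f : (Fin L → ℝ) → ℝ≥0∞}
    (hf : Measurable f) :
    ∫⁻ η, f η ∂noiseLaw L σ = ∫⁻ η, ∫⁻ x, f (Function.update η a x)
      ∂gaussianReal 0 (Real.toNNReal (σ ^ 2)) ∂noiseLaw L σ := by
  have h := lintegral_infinitePi_update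
    (fun _ : Fin L => gaussianReal 0 (Real.toNNReal (σ ^ 2))) a hf
  rwa [Measure.infinitePi_eq_pi] at h

theorem foldl_kalmanStep_congr {σ : ℝ} {l : List (Fin L)} {w w' : Fin L → ℝ}
    (h : ∀ e ∈ l, w e = w' e) (p : Belief d) :
    l.foldl (fun q e => kalmanStep σ (feature Φ e) (w e) q) p
      = l.foldl (fun q e => kalmanStep σ (feature Φ e) (w' e) q) p :=
  List.foldl_ext _ _ _ fun q e he => by rw [h e he]

/-- Since the list has no repetition, the noise of its head is not used again. After the head is
processed and the parameter redrawn from the new belief, the tail poses the same problem with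
independent noise. -/
theorem lintegral_foldl_kalmanStep {σ : ℝ} (hσ : 0 < σ) (l : List (Fin L)) (hl : l.Nodup)
    (p : Belief d) (hp : p.2.PosDef) {F : Belief d × Param d → ℝ≥0∞} (hF : Measurable F) :
    ∫⁻ η, ∫⁻ z, F (l.foldl (fun r e => kalmanStep σ (feature Φ e)
          ((linWeight Φ (gaussianSample p z) + η) e) r) p, gaussianSample p z)
        ∂stdGaussian (Param d) ∂noiseLaw L σ
      = ∫⁻ η, ∫⁻ z, posteriorMean F (l.foldl (fun r e => kalmanStep σ (feature Φ e)
          ((linWeight Φ (gaussianSample p z) + η) e) r) p)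
        ∂stdGaussian (Param d) ∂noiseLaw L σ := by
  induction l generalizing p with
  | nil => simp [posteriorMean]
  | cons a l ih =>
    -- Stated for a general `G` because it is applied to `F` and to its posterior mean; the
    -- induction hypothesis then compares the two inner integrals belief by belief.
    have key {G : Belief d × Param d → ℝ≥0∞} (hG : Measurable G) :
        ∫⁻ η, ∫⁻ z, G ((a :: l).foldl (fun r e => kalmanStep σ (feature Φ e)
          ((linWeight Φ (gaussianSample p z) + η) e) r) p, gaussianSample p z)
          ∂stdGaussian (Param d) ∂noiseLaw L σ
        = ∫⁻ x, ∫⁻ z, (fun q : Belief d => ∫⁻ η, ∫⁻ z', G (l.foldl (fun r e =>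
            kalmanStep σ (feature Φ e) ((linWeight Φ (gaussianSample q z') + η) e) r) q,
            gaussianSample q z') ∂stdGaussian (Param d) ∂noiseLaw L σ)
            (kalmanStep σ (feature Φ a) ((feature Φ a).ofLp ⬝ᵥ (gaussianSample p z).ofLp + x) p)
          ∂stdGaussian (Param d) ∂gaussianReal 0 (Real.toNNReal (σ ^ 2)) := by
      have hH : Measurable fun v : (Fin L → ℝ) × Belief d × Param d =>
          G (l.foldl (fun r e => kalmanStep σ (feature Φ e) ((linWeight Φ v.2.2 + v.1) e) r) v.2.1,
            v.2.2) := by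
        refine hG.comp (Measurable.prodMk ?_ measurable_snd.snd)
        exact (measurable_foldl_kalmanStep Φ σ l).comp
          (((((measurable_linWeight Φ).comp measurable_snd.snd)).add measurable_fst).prodMk
            measurable_snd.fst)
      have hH' : Measurable fun v : (Fin L → ℝ) × Param d =>
          G ((a :: l).foldl (fun r e => kalmanStep σ (feature Φ e)
          ((linWeight Φ (gaussianSample p v.2) + v.1) e) r) p, gaussianSample p v.2) := by
        have hs := (measurable_gaussianSample_right p).comp
          (measurable_snd : Measurable (Prod.snd : (Fin L → ℝ) × Param d → _))
        refine hG.comp (Measurable.prodMk ?_ hs)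
        exact (measurable_foldl_kalmanStep Φ σ (a :: l)).comp
          ((((measurable_linWeight Φ).comp hs).add measurable_fst).prodMk measurable_const)
      have hP : Measurable fun v : (Fin L → ℝ) × Belief d => posteriorMean (fun u : Belief d × Param d =>
          G (l.foldl (fun r e => kalmanStep σ (feature Φ e) ((linWeight Φ u.2 + v.1) e) r) u.1, u.2))
          v.2 := by
        have : Measurable fun y : ((Fin L → ℝ) × Belief d) × Param d =>
            (y.1.1, y.1.2, gaussianSample y.1.2 y.2) :=
          measurable_fst.fst.prodMk (measurable_fst.snd.prodMk
            (measurable_gaussianSample.comp (measurable_fst.snd.prodMk measurable_snd)))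
        exact (hH.comp this).lintegral_prod_right'
      have hK : Measurable fun y : ℝ × Param d => kalmanStep σ (feature Φ a)
          ((feature Φ a).ofLp ⬝ᵥ (gaussianSample p y.2).ofLp + y.1) p := by
        have hs := (measurable_gaussianSample_right p).comp
          (measurable_snd : Measurable (Prod.snd : ℝ × Param d → _))
        have hs' := (WithLp.measurable_ofLp 2 (Fin d → ℝ)).comp hs
        exact (measurable_kalmanStep σ (feature Φ a)).comp
          (((measurable_const.dotProduct hs').add measurable_fst).prodMk measurable_const)
      rw [lintegral_noiseLaw_update σ a hH'.lintegral_prod_right']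
      have step (η : Fin L → ℝ) :
          ∫⁻ x, ∫⁻ z, G ((a :: l).foldl (fun r e => kalmanStep σ (feature Φ e)
            ((linWeight Φ (gaussianSample p z) + Function.update η a x) e) r) p,
              gaussianSample p z)
            ∂stdGaussian (Param d) ∂gaussianReal 0 (Real.toNNReal (σ ^ 2))
          = ∫⁻ x, ∫⁻ z, posteriorMean (fun u : Belief d × Param d => G (l.foldl (fun r e =>
              kalmanStep σ (feature Φ e) ((linWeight Φ u.2 + η) e) r) u.1, u.2))
              (kalmanStep σ (feature Φ a) ((feature Φ a).ofLp ⬝ᵥ (gaussianSample p z).ofLp + x) p)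
            ∂stdGaussian (Param d) ∂gaussianReal 0 (Real.toNNReal (σ ^ 2)) := by
        refine Eq.trans ?_ (lintegral_kalmanStep hσ (feature Φ a) p hp
          (hH.comp (measurable_prodMk_left (x := η))))
        refine lintegral_congr fun x => lintegral_congr fun z => ?_
        rw [List.foldl_cons]
        have ha : (linWeight Φ (gaussianSample p z) + Function.update η a x) a
            = (feature Φ a).ofLp ⬝ᵥ (gaussianSample p z).ofLp + x := by
          rw [Pi.add_apply, Function.update_self]
          rfl
        rw [ha]
        congr 2
        refine foldl_kalmanStep_congr Φ (fun e he => ?_) _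
        have hne : e ≠ a := fun h => (List.nodup_cons.1 hl).1 (h ▸ he)
        rw [Pi.add_apply, Pi.add_apply, Function.update_of_ne hne]
      rw [lintegral_congr step]
      have hPK : Measurable fun y : (Fin L → ℝ) × ℝ × Param d =>
          posteriorMean (fun u : Belief d × Param d =>
          G (l.foldl (fun r e => kalmanStep σ (feature Φ e) ((linWeight Φ u.2 + y.1) e) r) u.1, u.2))
          (kalmanStep σ (feature Φ a)
          ((feature Φ a).ofLp ⬝ᵥ (gaussianSample p y.2.2).ofLp + y.2.1) p) :=
        hP.comp (measurable_fst.prodMk (hK.comp measurable_snd))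
      rw [lintegral_lintegral_swap]
      · refine lintegral_congr fun x => ?_
        rw [lintegral_lintegral_swap]
        · rfl
        · have hx : Measurable fun y : (Fin L → ℝ) × Param d => (y.1, x, y.2) :=
            measurable_fst.prodMk (measurable_const.prodMk measurable_snd)
          exact (hPK.comp hx).aemeasurable
      · have hx : Measurable fun y : ((Fin L → ℝ) × ℝ) × Param d => (y.1.1, y.1.2, y.2) :=
          measurable_fst.fst.prodMk (measurable_fst.snd.prodMk measurable_snd)
        exact (hPK.comp hx).lintegral_prod_right'.aemeasurable
    rw [key hF, key (G := fun u => posteriorMean F u.1)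
      ((measurable_posteriorMean hF).comp measurable_fst)]
    refine lintegral_congr fun x => lintegral_congr fun z => ?_
    exact ih (List.nodup_cons.1 hl).2 _ (by rw [kalmanStep_snd]; exact covStep_posDef hσ _ hp)

theorem lintegral_kalmanFilter {σ : ℝ} (hσ : 0 < σ) (A : Finset (Fin L))
    (p : Belief d) (hp : p.2.PosDef) {F : Belief d × Param d → ℝ≥0∞} (hF : Measurable F) :
    ∫⁻ η, ∫⁻ z, F (kalmanFilter Φ σ A (linWeight Φ (gaussianSample p z) + η) p,
        gaussianSample p z) ∂stdGaussian (Param d) ∂noiseLaw L σ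
      = ∫⁻ η, ∫⁻ z, posteriorMean F (kalmanFilter Φ σ A
        (linWeight Φ (gaussianSample p z) + η) p) ∂stdGaussian (Param d) ∂noiseLaw L σ := by
  unfold kalmanFilter
  exact lintegral_foldl_kalmanStep Φ hσ _ (A.sort_nodup _) p hp hF

end Posterior

/-! ### Beliefs depend only on the past -/

section Update

variable {L d : ℕ} {S : Type*} {Φ : Matrix (Fin L) (Fin d) ℝ} {lam σ : ℝ}
  {oracle : (Fin L → ℝ) → S → Finset (Fin L)}

theorem belief_update (θ : Param d) (s s' : S) (ξ : ℕ → EpisodeNoise L d S)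
    (x : EpisodeNoise L d S) {t t' : ℕ} (h : t ≤ t') :
    belief Φ lam σ oracle t (θ, s, Function.update ξ t' x)
      = belief Φ lam σ oracle t (θ, s', ξ) := by
  induction t with
  | zero => rfl
  | succ t ih =>
    have hne : t ≠ t' := by omega
    simp only [belief, weight, ih (by omega), Function.update_of_ne hne]

end Update

/-! ### Posterior law of the unknown parameter given the past -/

section JointLaw

open scoped ENNReal

attribute [local irreducible] kalmanStep gaussianSample kalmanFilter

variable {L d : ℕ} {S : Type*} [MeasurableSpace S] {Φ : Matrix (Fin L) (Fin d) ℝ} {lam σ : ℝ}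
  {oracle : (Fin L → ℝ) → S → Finset (Fin L)} (ν : Measure S) [IsProbabilityMeasure ν]

instance : IsProbabilityMeasure (law L d lam σ ν) := by
  unfold law; infer_instance

/-- The oracle seed of `A*` and the randomness of an episode may be replaced by fresh copies. -/
theorem lintegral_law_resample (t : ℕ) {G : Sample L d S → ℝ≥0∞} (hG : Measurable G) :
    ∫⁻ ω, G ω ∂law L d lam σ ν
      = ∫⁻ ω, ∫⁻ s, ∫⁻ x, G (ω.1, s, Function.update ω.2.2 t x)
          ∂episodeLaw L d σ ν ∂ν ∂law L d lam σ ν := by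
  have hu : Measurable fun y : (Sample L d S × S) × EpisodeNoise L d S =>
      (y.1.1.1, y.1.2, Function.update y.1.1.2.2 t y.2) := by
    refine measurable_fst.fst.fst.prodMk (measurable_fst.snd.prodMk ?_)
    exact measurable_update'.comp (measurable_fst.fst.snd.snd.prodMk measurable_snd)
  have hI : Measurable fun ω : Sample L d S => ∫⁻ s, ∫⁻ x, G (ω.1, s, Function.update ω.2.2 t x)
      ∂episodeLaw L d σ ν ∂ν :=
    ((hG.comp hu).lintegral_prod_right' (ν := episodeLaw L d σ ν)).lintegral_prod_right'
  rw [law, lintegral_prod _ hG.aemeasurable, lintegral_prod _ hI.aemeasurable]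
  refine lintegral_congr fun θ => ?_
  have hGθ : Measurable fun y : S × (ℕ → EpisodeNoise L d S) => G (θ, y) :=
    hG.comp measurable_prodMk_left
  have hIθ : Measurable fun y : S × (ℕ → EpisodeNoise L d S) =>
      ∫⁻ s, ∫⁻ x, G (θ, s, Function.update y.2 t x) ∂episodeLaw L d σ ν ∂ν :=
    hI.comp (measurable_prodMk_left (x := θ))
  refine (lintegral_prod _ hGθ.aemeasurable).trans ?_
  refine Eq.trans ?_ (lintegral_prod _ hIθ.aemeasurable).symm
  change _ = ∫⁻ _ : S, (∫⁻ ξ, ∫⁻ s, ∫⁻ x, G (θ, s, Function.update ξ t x)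
    ∂episodeLaw L d σ ν ∂ν ∂Measure.infinitePi fun _ : ℕ => episodeLaw L d σ ν) ∂ν
  rw [lintegral_const, measure_univ, mul_one]
  refine Eq.trans ?_ (lintegral_lintegral_swap (ν := ν)
    (μ := Measure.infinitePi fun _ : ℕ => episodeLaw L d σ ν)
    (f := fun ξ s => ∫⁻ x, G (θ, s, Function.update ξ t x) ∂episodeLaw L d σ ν) ?_).symm
  · refine lintegral_congr fun s => ?_
    exact lintegral_infinitePi_update (fun _ : ℕ => episodeLaw L d σ ν) t
      (hGθ.comp (measurable_prodMk_left (x := s)))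
  · have hv : Measurable fun y : ((ℕ → EpisodeNoise L d S) × S) × EpisodeNoise L d S =>
        (θ, y.1.2, Function.update y.1.1 t y.2) := by
      refine measurable_const.prodMk (measurable_fst.snd.prodMk ?_)
      exact measurable_update'.comp (measurable_fst.fst.prodMk measurable_snd)
    exact ((hG.comp hv).lintegral_prod_right' (ν := episodeLaw L d σ ν)).aemeasurable

/-- One episode, as an operator on functions of the belief and of the unknown parameter. -/
noncomputable def episodeMean (Φ : Matrix (Fin L) (Fin d) ℝ) (σ : ℝ)
    (oracle : (Fin L → ℝ) → S → Finset (Fin L)) (G : Belief d × Param d → ℝ≥0∞)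
    (q : Belief d × Param d) : ℝ≥0∞ :=
  ∫⁻ x, G (kalmanFilter Φ σ (chooseSet Φ oracle q.1 x) (linWeight Φ q.2 + x.2.2) q.1, q.2)
    ∂episodeLaw L d σ ν

variable {ν}

theorem measurable_episode
    (hmeas : ∀ A, MeasurableSet {q : (Fin L → ℝ) × S | oracle q.1 q.2 = A}) :
    Measurable fun y : (Belief d × Param d) × EpisodeNoise L d S =>
      (kalmanFilter Φ σ (chooseSet Φ oracle y.1.1 y.2) (linWeight Φ y.1.2 + y.2.2.2) y.1.1,
        y.1.2) := by
  refine Measurable.prodMk ?_ measurable_fst.snd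
  have h1 : Measurable fun y : (Belief d × Param d) × EpisodeNoise L d S =>
      chooseSet Φ oracle y.1.1 y.2 :=
    (measurable_chooseSet hmeas).comp (measurable_fst.fst.prodMk measurable_snd)
  exact (measurable_kalmanFilter Φ σ).comp (h1.prodMk
    ((((measurable_linWeight Φ).comp measurable_fst.snd).add measurable_snd.snd.snd).prodMk
      measurable_fst.fst))

theorem measurable_episodeMean
    (hmeas : ∀ A, MeasurableSet {q : (Fin L → ℝ) × S | oracle q.1 q.2 = A})
    {G : Belief d × Param d → ℝ≥0∞} (hG : Measurable G) :
    Measurable (episodeMean ν Φ σ oracle G) :=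
  (hG.comp (measurable_episode hmeas)).lintegral_prod_right'

theorem lintegral_belief_succ
    (hmeas : ∀ A, MeasurableSet {q : (Fin L → ℝ) × S | oracle q.1 q.2 = A}) (t : ℕ)
    {G : Belief d × Param d → ℝ≥0∞} (hG : Measurable G) :
    ∫⁻ ω, G (belief Φ lam σ oracle (t + 1) ω, ω.1) ∂law L d lam σ ν
      = ∫⁻ ω, episodeMean ν Φ σ oracle G (belief Φ lam σ oracle t ω, ω.1) ∂law L d lam σ ν := by
  refine (lintegral_law_resample ν t (hG.comp ((measurable_belief (Φ := Φ) (lam := lam) (σ := σ)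
    hmeas (t + 1)).prodMk measurable_fst))).trans (lintegral_congr fun ω => ?_)
  have h (s : S) (x : EpisodeNoise L d S) :
      (belief Φ lam σ oracle (t + 1) (ω.1, s, Function.update ω.2.2 t x))
      = kalmanFilter Φ σ (chooseSet Φ oracle (belief Φ lam σ oracle t ω) x)
        (linWeight Φ ω.1 + x.2.2) (belief Φ lam σ oracle t ω) := by
    rw [belief, belief_update ω.1 s ω.2.1 ω.2.2 x le_rfl, weight]
    simp only [Function.update_self]
  simp only [Function.comp_apply, h]
  rw [lintegral_const, measure_univ, mul_one]
  rfl

/-- The chosen set depends on the agent's sample and seed, which are independent of the parameter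
and of the noise. By Tonelli these can be fixed first, leaving a filter with a deterministic set. -/
theorem posteriorMean_episodeMean (hσ : 0 < σ)
    (hmeas : ∀ A, MeasurableSet {q : (Fin L → ℝ) × S | oracle q.1 q.2 = A})
    {F : Belief d × Param d → ℝ≥0∞} (hF : Measurable F) (p : Belief d) (hp : p.2.PosDef) :
    posteriorMean (episodeMean ν Φ σ oracle F) p
      = posteriorMean (episodeMean ν Φ σ oracle fun q => posteriorMean F q.1) p := by
  have key {G : Belief d × Param d → ℝ≥0∞} (hG : Measurable G) :
      posteriorMean (episodeMean ν Φ σ oracle G) p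
      = ∫⁻ z, ∫⁻ s, ∫⁻ η, ∫⁻ z', G (kalmanFilter Φ σ (oracle (linWeight Φ (gaussianSample p z)) s)
          (linWeight Φ (gaussianSample p z') + η) p, gaussianSample p z')
          ∂stdGaussian (Param d) ∂noiseLaw L σ ∂ν ∂stdGaussian (Param d) := by
    have hz : Measurable fun y : Param d × EpisodeNoise L d S =>
        ((p, gaussianSample p y.1), y.2) :=
      (measurable_const.prodMk ((measurable_gaussianSample_right p).comp measurable_fst)).prodMk
        measurable_snd
    have h1 := (hG.comp (measurable_episode (Φ := Φ) (σ := σ) hmeas)).comp hz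
    unfold posteriorMean episodeMean
    refine (lintegral_lintegral_swap (μ := stdGaussian (Param d)) (ν := episodeLaw L d σ ν)
      (f := fun z x => G (kalmanFilter Φ σ (chooseSet Φ oracle p x)
        (linWeight Φ (gaussianSample p z) + x.2.2) p, gaussianSample p z)) h1.aemeasurable).trans ?_
    have h2 := (h1.comp (measurable_swap)).lintegral_prod_right' (ν := stdGaussian (Param d))
    refine (lintegral_prod (μ := stdGaussian (Param d)) (ν := ν.prod (noiseLaw L σ)) _
      h2.aemeasurable).trans ?_
    refine lintegral_congr fun z => ?_
    exact lintegral_prod (μ := ν) (ν := noiseLaw L σ) _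
      (h2.comp (measurable_prodMk_left (x := z))).aemeasurable
  rw [key hF, key (G := fun q => posteriorMean F q.1) ((measurable_posteriorMean hF).comp measurable_fst)]
  refine lintegral_congr fun z => lintegral_congr fun s => ?_
  exact lintegral_kalmanFilter Φ hσ _ p hp hF

/-- The conditional law of `θ*` at the start of episode `t` is `N(θ̄_t, Σ_t)`. -/
theorem lintegral_belief (hΦ : ∀ e, ‖feature Φ e‖ ≤ 1) (hσ : 0 < σ) (hlam : 0 < lam)
    (hmeas : ∀ A, MeasurableSet {q : (Fin L → ℝ) × S | oracle q.1 q.2 = A}) (t : ℕ)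
    {F : Belief d × Param d → ℝ≥0∞} (hF : Measurable F) :
    ∫⁻ ω, F (belief Φ lam σ oracle t ω, ω.1) ∂law L d lam σ ν
      = ∫⁻ ω, posteriorMean F (belief Φ lam σ oracle t ω) ∂law L d lam σ ν := by
  induction t generalizing F with
  | zero =>
    set p : Belief d := (0, lam ^ 2 • (1 : Matrix (Fin d) (Fin d) ℝ)) with hp
    change ∫⁻ ω, F (p, ω.1) ∂law L d lam σ ν = ∫⁻ ω, posteriorMean F p ∂law L d lam σ ν
    rw [lintegral_const, measure_univ, mul_one]
    have hFp : Measurable fun θ => F (p, θ) := hF.comp measurable_prodMk_left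
    refine Eq.trans ?_ (lintegral_multivariateGaussian p hFp)
    exact (measurePreserving_fst (μ := multivariateGaussian p.1 p.2) (ν := ν.prod
      (Measure.infinitePi fun _ : ℕ => episodeLaw L d σ ν))).lintegral_comp hFp
  | succ t ih =>
    have hP : Measurable fun q : Belief d × Param d => posteriorMean F q.1 :=
      (measurable_posteriorMean hF).comp measurable_fst
    -- The induction hypothesis is used for `F` and for its posterior mean: once `θ*` is redrawn
    -- from the belief at time `t`, one episode does not distinguish them.
    rw [lintegral_belief_succ hmeas t hF, ih (measurable_episodeMean hmeas hF)]
    refine Eq.trans ?_ (lintegral_belief_succ hmeas t hP).symm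
    rw [ih (measurable_episodeMean hmeas hP)]
    exact lintegral_congr fun ω =>
      posteriorMean_episodeMean hσ hmeas hF _ (belief_posDef hΦ hσ hlam ω t)

variable (ν) in
/-- The law of the belief at the start of episode `t`. -/
noncomputable def beliefLaw (Φ : Matrix (Fin L) (Fin d) ℝ) (lam σ : ℝ)
    (oracle : (Fin L → ℝ) → S → Finset (Fin L)) (t : ℕ) : Measure (Belief d) :=
  (law L d lam σ ν).map (belief Φ lam σ oracle t)

theorem isProbabilityMeasure_beliefLaw
    (hmeas : ∀ A, MeasurableSet {q : (Fin L → ℝ) × S | oracle q.1 q.2 = A}) (t : ℕ) :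
    IsProbabilityMeasure (beliefLaw ν Φ lam σ oracle t) :=
  Measure.isProbabilityMeasure_map (measurable_belief hmeas t).aemeasurable

/-- The joint law of the belief, of `θ*`, of the oracle seed of `A*` and of the randomness of
episode `t`. -/
theorem map_belief_eq (hΦ : ∀ e, ‖feature Φ e‖ ≤ 1) (hσ : 0 < σ) (hlam : 0 < lam)
    (hmeas : ∀ A, MeasurableSet {q : (Fin L → ℝ) × S | oracle q.1 q.2 = A}) (t : ℕ) :
    (law L d lam σ ν).map (fun ω => (belief Φ lam σ oracle t ω, ω.1, ω.2.1, ω.2.2 t))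
      = ((beliefLaw ν Φ lam σ oracle t).prod ((stdGaussian (Param d)).prod
          (ν.prod (episodeLaw L d σ ν)))).map
        (fun q => (q.1, gaussianSample q.1 q.2.1, q.2.2.1, q.2.2.2)) := by
  have := isProbabilityMeasure_beliefLaw (ν := ν) (Φ := Φ) (lam := lam) (σ := σ) hmeas t
  have hB := measurable_belief (Φ := Φ) (lam := lam) (σ := σ) hmeas t
  have hm1 : Measurable fun ω : Sample L d S =>
      (belief Φ lam σ oracle t ω, ω.1, ω.2.1, ω.2.2 t) :=
    hB.prodMk (measurable_fst.prodMk (measurable_snd.fst.prodMk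
      ((measurable_pi_apply t).comp measurable_snd.snd)))
  have hm2 : Measurable fun q : Belief d × Param d × S × EpisodeNoise L d S =>
      (q.1, gaussianSample q.1 q.2.1, q.2.2.1, q.2.2.2) :=
    measurable_fst.prodMk ((measurable_gaussianSample.comp
      (measurable_fst.prodMk measurable_snd.fst)).prodMk
        (measurable_snd.snd.fst.prodMk measurable_snd.snd.snd))
  refine Measure.ext_of_lintegral _ fun F hF => ?_
  rw [lintegral_map hF hm1, lintegral_map hF hm2]
  have hF2 := hF.comp hm2
  refine (lintegral_law_resample ν t (hF.comp hm1)).trans ?_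
  have hF3 : Measurable fun q : Belief d × Param d =>
      ∫⁻ s, ∫⁻ x, F (q.1, q.2, s, x) ∂episodeLaw L d σ ν ∂ν := by
    have h : Measurable fun y : ((Belief d × Param d) × S) × EpisodeNoise L d S =>
        (y.1.1.1, y.1.1.2, y.1.2, y.2) :=
      measurable_fst.fst.fst.prodMk (measurable_fst.fst.snd.prodMk
        (measurable_fst.snd.prodMk measurable_snd))
    exact ((hF.comp h).lintegral_prod_right' (ν := episodeLaw L d σ ν)).lintegral_prod_right'
  have e1 (ω : Sample L d S) (s : S) (x : EpisodeNoise L d S) :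
      belief Φ lam σ oracle t (ω.1, s, Function.update ω.2.2 t x) = belief Φ lam σ oracle t ω :=
    belief_update ω.1 s ω.2.1 ω.2.2 x le_rfl
  simp only [Function.comp_apply, e1, Function.update_self]
  rw [lintegral_belief hΦ hσ hlam hmeas t hF3]
  refine Eq.symm ((lintegral_prod _ hF2.aemeasurable).trans ?_)
  rw [beliefLaw, lintegral_map (hF2.lintegral_prod_right') hB]
  refine lintegral_congr fun ω => ?_
  set p := belief Φ lam σ oracle t ω
  have hFp := hF2.comp (measurable_prodMk_left (x := p))
  refine (lintegral_prod _ hFp.aemeasurable).trans (lintegral_congr fun z => ?_)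
  exact lintegral_prod _ (hFp.comp (measurable_prodMk_left (x := z))).aemeasurable

end JointLaw

/-! ### Gaussian maximal inequality -/

section GaussianMaximum

open Real

variable {d : ℕ}

theorem map_inner_stdGaussian (a : Param d) :
    (stdGaussian (Param d)).map (fun z => inner ℝ a z)
      = gaussianReal 0 (‖a‖ ^ 2).toNNReal := by
  have h := IsGaussian.map_eq_gaussianReal (μ := stdGaussian (Param d)) (innerSL ℝ a)
  rw [variance_dual_stdGaussian, integral_strongDual_stdGaussian, innerSL_apply_norm] at h
  exact h

theorem measurable_inner_left (a : Param d) : Measurable fun z : Param d => (inner ℝ a z : ℝ) := by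
  fun_prop

theorem integrable_inner_stdGaussian (a : Param d) :
    Integrable (fun z => (inner ℝ a z : ℝ)) (stdGaussian (Param d)) :=
  (innerSL ℝ a).integrable_comp IsGaussian.integrable_id

theorem integral_inner_stdGaussian (a : Param d) :
    ∫ z, (inner ℝ a z : ℝ) ∂stdGaussian (Param d) = 0 :=
  integral_strongDual_stdGaussian (innerSL ℝ a)

theorem integrable_norm_sq_stdGaussian :
    Integrable (fun z => ‖z‖ ^ 2) (stdGaussian (Param d)) :=
  (IsGaussian.memLp_two_id (μ := stdGaussian (Param d))).integrable_norm_pow (by norm_num)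

theorem integral_sq_apply_stdGaussian (i : Fin d) :
    ∫ z : Param d, z i ^ 2 ∂stdGaussian (Param d) = 1 := by
  have h1 : ∀ z : Param d, z i = inner ℝ (EuclideanSpace.single i (1 : ℝ)) z := fun z => by
    rw [EuclideanSpace.inner_single_left]
    simp
  simp_rw [h1]
  have h2 := variance_dual_stdGaussian (innerSL ℝ (EuclideanSpace.single i (1 : ℝ)))
  rw [variance_eq_integral (by fun_prop), integral_strongDual_stdGaussian,
    innerSL_apply_norm] at h2
  simpa using h2

theorem integral_norm_sq_stdGaussian :
    ∫ z : Param d, ‖z‖ ^ 2 ∂stdGaussian (Param d) = d := by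
  simp_rw [EuclideanSpace.real_norm_sq_eq]
  rw [integral_finsetSum]
  · simp [integral_sq_apply_stdGaussian]
  · intro i _
    refine integrable_norm_sq_stdGaussian.mono' (by fun_prop) (ae_of_all _ fun z => ?_)
    rw [norm_pow]
    exact pow_le_pow_left₀ (norm_nonneg _) (PiLp.norm_apply_le z i) 2

theorem integral_exp_sq_div_four_gaussianReal :
    ∫ x, exp (x ^ 2 / 4) ∂gaussianReal 0 1 = √2 := by
  rw [integral_gaussianReal_eq_integral_smul one_ne_zero]
  have h (x : ℝ) : gaussianPDFReal 0 1 x • exp (x ^ 2 / 4)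
      = (√(2 * π))⁻¹ * exp (-(1 / 4) * x ^ 2) := by
    rw [gaussianPDFReal, smul_eq_mul, mul_assoc, ← exp_add]
    simp only [NNReal.coe_one, mul_one, sub_zero]
    congr 2
    ring
  simp_rw [h]
  rw [integral_const_mul, integral_gaussian, ← sqrt_inv, ← sqrt_mul (by positivity)]
  congr 1
  field_simp
  norm_num

theorem integral_exp_sq_inner_stdGaussian {a : Param d} (ha : ‖a‖ = 1) :
    ∫ z, exp ((inner ℝ a z) ^ 2 / 4) ∂stdGaussian (Param d) = √2 := by
  have h := integral_map (μ := stdGaussian (Param d)) (measurable_inner_left a).aemeasurable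
    (f := fun x : ℝ => exp (x ^ 2 / 4)) (by fun_prop)
  rw [← h, map_inner_stdGaussian, ha]
  simpa using integral_exp_sq_div_four_gaussianReal

theorem exp_sq_inner_normalized (a : Param d) :
    Integrable (fun z => exp ((inner ℝ (‖a‖⁻¹ • a) z) ^ 2 / 4)) (stdGaussian (Param d)) ∧
      ∫ z, exp ((inner ℝ (‖a‖⁻¹ • a) z) ^ 2 / 4) ∂stdGaussian (Param d) ≤ √2 := by
  rcases eq_or_ne a 0 with rfl | ha
  · simp
  · have hn : ‖‖a‖⁻¹ • a‖ = 1 := by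
      rw [norm_smul, norm_inv, norm_norm, inv_mul_cancel₀ (norm_ne_zero_iff.2 ha)]
    have h := integral_exp_sq_inner_stdGaussian hn
    refine ⟨?_, h.le⟩
    by_contra hc
    -- A non-integrable function has integral `0` by convention, which contradicts the value `√2`.
    rw [integral_undef hc] at h
    exact (sqrt_pos.2 two_pos).ne h

theorem sq_inner_eq_normalized (a z : Param d) :
    (inner ℝ a z) ^ 2 = ‖a‖ ^ 2 * (inner ℝ (‖a‖⁻¹ • a) z) ^ 2 := by
  rcases eq_or_ne a 0 with rfl | ha
  · simp
  · have := norm_ne_zero_iff.2 ha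
    rw [real_inner_smul_left]
    field_simp

/-- A maximal inequality for `L` (normalized) Gaussian variables in dimension `d`. -/
theorem exists_integrable_bound_sq_inner {L : ℕ} (hL : 2 ≤ L) (u : Fin L → Param d) :
    ∃ M : Param d → ℝ, Integrable M (stdGaussian (Param d)) ∧ (∀ z, 0 ≤ M z) ∧
      (∀ e z, (inner ℝ (u e) z) ^ 2 ≤ ‖u e‖ ^ 2 * M z) ∧
      ∫ z, M z ∂stdGaussian (Param d) ≤ 8 * min (log L) d := by
  have hL' : (2 : ℝ) ≤ L := by exact_mod_cast hL
  have hlogL : 0.69 ≤ log L :=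
    (by have := log_two_gt_d9; linarith : 0.69 ≤ log 2).trans (log_le_log two_pos hL')
  rcases le_total (log L) d with h | h
  · rw [min_eq_left h]
    -- With `X` a normalized variable, `y + 1 ≤ exp y` at `y = X²/4 - log L` gives `X²/4 ≤ log L - 1
    -- + exp(X²/4)/L`, and summing the exponentials makes the bound uniform in `e`. The mean is at
    -- most `4 (log L - 1 + √2)`, which is below `8 log L` because `L ≥ 2`.
    refine ⟨fun z => 4 * (log L - 1 + (∑ e, exp ((inner ℝ (‖u e‖⁻¹ • u e) z) ^ 2 / 4)) / L),
      ?_, fun z => ?_, fun e z => ?_, ?_⟩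
    · refine (((integrable_const _).add ?_)).const_mul _
      exact (integrable_finsetSum _ fun e _ => (exp_sq_inner_normalized (u e)).1).div_const _
    · have h1 : (L : ℝ) ≤ ∑ e, exp ((inner ℝ (‖u e‖⁻¹ • u e) z) ^ 2 / 4) := by
        have : ∑ _e : Fin L, (1 : ℝ) = L := by simp
        rw [← this]
        exact Finset.sum_le_sum fun e _ => one_le_exp (by positivity)
      have h2 : 1 ≤ (∑ e, exp ((inner ℝ (‖u e‖⁻¹ • u e) z) ^ 2 / 4)) / L :=
        (one_le_div (by linarith)).2 h1
      simp only
      linarith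
    · rw [sq_inner_eq_normalized]
      refine mul_le_mul_of_nonneg_left ?_ (by positivity)
      have h1 := add_one_le_exp ((inner ℝ (‖u e‖⁻¹ • u e) z) ^ 2 / 4 - log L)
      rw [exp_sub, exp_log (by linarith)] at h1
      have h2 : exp ((inner ℝ (‖u e‖⁻¹ • u e) z) ^ 2 / 4)
          ≤ ∑ e, exp ((inner ℝ (‖u e‖⁻¹ • u e) z) ^ 2 / 4) :=
        Finset.single_le_sum (f := fun e => exp ((inner ℝ (‖u e‖⁻¹ • u e) z) ^ 2 / 4))
          (fun e _ => (exp_pos _).le) (Finset.mem_univ e)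
      have h3 := div_le_div_of_nonneg_right h2 (by linarith : (0 : ℝ) ≤ L)
      linarith
    · have hi := integrable_finsetSum Finset.univ fun e _ => (exp_sq_inner_normalized (u e)).1
      rw [integral_const_mul, integral_add (integrable_const _) (hi.div_const _),
        integral_div, integral_finsetSum _ fun e _ => (exp_sq_inner_normalized (u e)).1]
      have h1 : ∑ e, ∫ z, exp ((inner ℝ (‖u e‖⁻¹ • u e) z) ^ 2 / 4) ∂stdGaussian (Param d)
          ≤ L * √2 :=
        (Finset.sum_le_sum fun e _ => (exp_sq_inner_normalized (u e)).2).trans_eq (by simp)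
      have h2 : (∑ e, ∫ z, exp ((inner ℝ (‖u e‖⁻¹ • u e) z) ^ 2 / 4) ∂stdGaussian (Param d)) / L
          ≤ √2 := (div_le_iff₀' (by linarith)).2 h1
      have h3 : √2 ≤ 1.5 := by
        rw [sqrt_le_left (by norm_num)]
        norm_num
      rw [integral_const, probReal_univ, one_smul]
      linarith
  · rw [min_eq_right h]
    -- In low dimension Cauchy–Schwarz suffices, and `‖z‖²` has mean `d`.
    refine ⟨fun z => ‖z‖ ^ 2, integrable_norm_sq_stdGaussian, fun z => by positivity,
      fun e z => ?_, ?_⟩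
    · rw [← mul_pow, ← sq_abs]
      exact pow_le_pow_left₀ (abs_nonneg _) (abs_real_inner_le_norm _ _) 2
    · rw [integral_norm_sq_stdGaussian]
      have : (0 : ℝ) ≤ d := by positivity
      linarith

end GaussianMaximum

/-! ### Coordinates of a sample as inner products with `Σ^{1/2} φ` -/

section SampleDirection

open Matrix

variable {d : ℕ}

theorem dotProduct_gaussianSample (p : Belief d) (φ z : Param d) :
    φ.ofLp ⬝ᵥ (gaussianSample p z).ofLp
      = φ.ofLp ⬝ᵥ p.1.ofLp + inner ℝ (toEuclideanCLM (𝕜 := ℝ) (CFC.sqrt p.2) φ) z := by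
  have hs : IsSelfAdjoint (toEuclideanCLM (n := Fin d) (𝕜 := ℝ) (CFC.sqrt p.2)) :=
    (CFC.sqrt_nonneg p.2).isSelfAdjoint.map _
  rw [← inner_eq_dotProduct, ← inner_eq_dotProduct, gaussianSample, inner_add_right,
    ← ContinuousLinearMap.adjoint_inner_left, hs.adjoint_eq]

theorem norm_sq_sqrt_apply {M : Matrix (Fin d) (Fin d) ℝ} (hM : M.PosSemidef) (φ : Param d) :
    ‖toEuclideanCLM (𝕜 := ℝ) (CFC.sqrt M) φ‖ ^ 2 = φ.ofLp ⬝ᵥ (M *ᵥ φ.ofLp) := by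
  have hs : IsSelfAdjoint (toEuclideanCLM (n := Fin d) (𝕜 := ℝ) (CFC.sqrt M)) :=
    (CFC.sqrt_nonneg M).isSelfAdjoint.map _
  rw [← real_inner_self_eq_norm_sq, ← ContinuousLinearMap.adjoint_inner_right, hs.adjoint_eq,
    ← ContinuousLinearMap.comp_apply, ← ContinuousLinearMap.mul_def, ← map_mul,
    CFC.sqrt_mul_sqrt_self _ hM.nonneg, inner_toEuclideanCLM]

end SampleDirection

theorem _root_.MeasureTheory.MeasurePreserving.integral_comp_of_measurable {α β : Type*}
    [MeasurableSpace α] [MeasurableSpace β] {μ : Measure α} {ν : Measure β} {f : α → β}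
    (hf : MeasurePreserving f μ ν) {g : β → ℝ} (hg : Measurable g) :
    ∫ x, g (f x) ∂μ = ∫ y, g y ∂ν := by
  rw [← hf.map_eq, integral_map hf.measurable.aemeasurable hg.aestronglyMeasurable]

theorem integral_add_add_sub {α : Type*} [MeasurableSpace α] {μ : Measure α}
    {f g h f' g' h' : α → ℝ} (hf : Integrable f μ) (hg : Integrable g μ) (hh : Integrable h μ)
    (hf' : Integrable f' μ) (hg' : Integrable g' μ) (hh' : Integrable h' μ) :
    ∫ x, (f x + g x + h x - (f' x + g' x + h' x)) ∂μ
      = ∫ x, f x ∂μ + ∫ x, g x ∂μ + ∫ x, h x ∂μ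
        - (∫ x, f' x ∂μ + ∫ x, g' x ∂μ + ∫ x, h' x ∂μ) := by
  have h1 : Integrable (fun x => f x + g x) μ := hf.add hg
  have h2 : Integrable (fun x => f' x + g' x) μ := hf'.add hg'
  have h3 : Integrable (fun x => f x + g x + h x) μ := h1.add hh
  have h4 : Integrable (fun x => f' x + g' x + h' x) μ := h2.add hh'
  rw [integral_sub h3 h4, integral_add h1 hh, integral_add h2 hh', integral_add hf hg,
    integral_add hf' hg']

/-! ### Returns of random sets -/

section SetReturn

variable {L : ℕ} {α β : Type*} [MeasurableSpace α] [MeasurableSpace β]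

theorem setReturn_add (A : Finset (Fin L)) (v w : Fin L → ℝ) :
    setReturn A (v + w) = setReturn A v + setReturn A w :=
  Finset.sum_add_distrib

theorem setReturn_eq_sum_indicator (A : Finset (Fin L)) (v : Fin L → ℝ) :
    setReturn A v = ∑ e, (if e ∈ A then 1 else 0) * v e := by
  simp [setReturn]

theorem measurable_indicator_mem {A : α → Finset (Fin L)} (hA : Measurable A) (e : Fin L) :
    Measurable fun a => (if e ∈ A a then (1 : ℝ) else 0) :=
  (Measurable.of_discrete (f := fun B : Finset (Fin L) => if e ∈ B then (1 : ℝ) else 0)).comp hA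

theorem integrable_indicator_mem_mul {μ : Measure α} {A : α → Finset (Fin L)} (hA : Measurable A)
    (e : Fin L) {f : α → ℝ} (hf : Integrable f μ) :
    Integrable (fun a => (if e ∈ A a then (1 : ℝ) else 0) * f a) μ := by
  refine hf.bdd_mul (c := 1) (measurable_indicator_mem hA e).aestronglyMeasurable
    (ae_of_all _ fun a => ?_)
  split_ifs <;> simp

theorem integrable_setReturn {μ : Measure α} {A : α → Finset (Fin L)} (hA : Measurable A)
    {v : α → Fin L → ℝ} (hv : ∀ e, Integrable (fun a => v a e) μ) :
    Integrable (fun a => setReturn (A a) (v a)) μ := by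
  simp only [setReturn_eq_sum_indicator]
  exact integrable_finsetSum _ fun e _ => integrable_indicator_mem_mul hA e (hv e)

/-- A random set independent of a centred weight vector has zero expected return. This removes both
noise terms and the fluctuation term of `A^t`. -/
theorem integral_prod_setReturn_eq_zero {μ : Measure α} {μ' : Measure β} [IsProbabilityMeasure μ]
    [IsProbabilityMeasure μ'] {A : α → Finset (Fin L)} (hA : Measurable A)
    {v : β → Fin L → ℝ} (hv : ∀ e, Integrable (fun b => v b e) μ') (h0 : ∀ e, ∫ b, v b e ∂μ' = 0) :
    ∫ q, setReturn (A q.1) (v q.2) ∂μ.prod μ' = 0 := by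
  simp only [setReturn_eq_sum_indicator]
  rw [integral_finsetSum]
  · refine Finset.sum_eq_zero fun e _ => ?_
    rw [integral_prod_mul (fun a => if e ∈ A a then (1 : ℝ) else 0) (fun b => v b e), h0, mul_zero]
  · intro e _
    exact integrable_indicator_mem_mul (hA.comp measurable_fst) e ((hv e).comp_snd μ)

theorem setReturn_inner_le {d K : ℕ} {A : Finset (Fin L)} (hA : A.card ≤ K)
    {u : Fin L → Param d} {z : Param d} {m γ : ℝ} (hm : 0 ≤ m)
    (h : ∀ e, (inner ℝ (u e) z) ^ 2 ≤ ‖u e‖ ^ 2 * m) (hγ : 0 < γ) :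
    setReturn A (fun e => inner ℝ (u e) z) ≤ (K / γ * ∑ e ∈ A, ‖u e‖ ^ 2 + γ * m) / 2 := by
  rcases Nat.eq_zero_or_pos K with rfl | hK
  · have : A = ∅ := by simpa using hA
    subst this
    simp only [setReturn, Finset.sum_empty]
    positivity
  have hK' : (0 : ℝ) < K := by exact_mod_cast hK
  -- Arithmetic-geometric mean inequality for each item. The weights `K/γ` and `γ/K` are chosen so
  -- that the `m`-terms of at most `K` items add up to at most `γ m/2`.
  have h1 (e : Fin L) : inner ℝ (u e) z ≤ K / γ / 2 * ‖u e‖ ^ 2 + γ * m / (2 * K) := by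
    have h2 : inner ℝ (u e) z ≤ √(‖u e‖ ^ 2 * m) :=
      (le_abs_self _).trans (Real.abs_le_sqrt (h e))
    refine h2.trans (Real.sqrt_le_iff.2 ⟨by positivity, ?_⟩)
    have h3 : (K / γ / 2 * ‖u e‖ ^ 2 + γ * m / (2 * K)) ^ 2 - ‖u e‖ ^ 2 * m
        = (K / γ / 2 * ‖u e‖ ^ 2 - γ * m / (2 * K)) ^ 2 := by
      field_simp
      ring
    nlinarith [sq_nonneg (K / γ / 2 * ‖u e‖ ^ 2 - γ * m / (2 * K))]
  calc setReturn A (fun e => inner ℝ (u e) z)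
      ≤ ∑ e ∈ A, (K / γ / 2 * ‖u e‖ ^ 2 + γ * m / (2 * K)) := Finset.sum_le_sum fun e _ => h1 e
    _ = K / γ / 2 * ∑ e ∈ A, ‖u e‖ ^ 2 + A.card * (γ * m / (2 * K)) := by
      rw [Finset.sum_add_distrib, ← Finset.mul_sum, Finset.sum_const, nsmul_eq_mul]
    _ ≤ K / γ / 2 * ∑ e ∈ A, ‖u e‖ ^ 2 + K * (γ * m / (2 * K)) := by gcongr
    _ = _ := by
      field_simp

end SetReturn

/-! ### Marginals of the episode randomness -/

section Noise

variable {L d : ℕ} {S : Type*} [MeasurableSpace S] {σ : ℝ} {ν : Measure S} [IsProbabilityMeasure ν]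

theorem integrable_noiseLaw_eval (e : Fin L) : Integrable (fun η => η e) (noiseLaw L σ) :=
  (measurePreserving_eval (fun _ : Fin L => gaussianReal 0 (Real.toNNReal (σ ^ 2)))
    e).integrable_comp_of_integrable (g := fun x : ℝ => x) IsGaussian.integrable_id

theorem integral_noiseLaw_eval (e : Fin L) : ∫ η, η e ∂noiseLaw L σ = 0 := by
  have h := integral_map (μ := noiseLaw L σ) (measurable_pi_apply e).aemeasurable
    (f := fun x : ℝ => x) (by fun_prop)
  rw [(measurePreserving_eval _ e).map_eq, integral_id_gaussianReal] at h
  exact h.symm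

theorem measurePreserving_episode_seed :
    MeasurePreserving (fun x : EpisodeNoise L d S => (x.1, x.2.1)) (episodeLaw L d σ ν)
      ((stdGaussian (Param d)).prod ν) :=
  (MeasurePreserving.id _).prod measurePreserving_fst

theorem measurePreserving_episode_noise :
    MeasurePreserving (fun x : EpisodeNoise L d S => x.2.2) (episodeLaw L d σ ν) (noiseLaw L σ) :=
  measurePreserving_snd.comp measurePreserving_snd

theorem measurePreserving_episode_assoc :
    MeasurePreserving (fun x : EpisodeNoise L d S => ((x.1, x.2.1), x.2.2)) (episodeLaw L d σ ν)
      (((stdGaussian (Param d)).prod ν).prod (noiseLaw L σ)) :=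
  (measurePreserving_prodAssoc (stdGaussian (Param d)) ν (noiseLaw L σ)).symm

end Noise

/-! ### Regret of one episode given the belief -/

section EpisodeRegret

attribute [local irreducible] gaussianSample linWeight totalVar setReturn

variable {L d K : ℕ} {S : Type*} [MeasurableSpace S] {Φ : Matrix (Fin L) (Fin d) ℝ} {lam σ : ℝ}
  {oracle : (Fin L → ℝ) → S → Finset (Fin L)} {ν : Measure S} [IsProbabilityMeasure ν]

/-- The law of the sampled direction of `θ*`, of the oracle seed of `A*` and of the randomness of an
episode, given the past. -/
noncomputable abbrev freshLaw (L d : ℕ) (σ : ℝ) (ν : Measure S) [IsProbabilityMeasure ν] :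
    Measure (Param d × S × EpisodeNoise L d S) :=
  (stdGaussian (Param d)).prod (ν.prod (episodeLaw L d σ ν))

theorem measurePreserving_fresh_assoc :
    MeasurePreserving (fun q : Param d × S × EpisodeNoise L d S => ((q.1, q.2.1), q.2.2))
      (freshLaw L d σ ν) (((stdGaussian (Param d)).prod ν).prod (episodeLaw L d σ ν)) :=
  (measurePreserving_prodAssoc (stdGaussian (Param d)) ν (episodeLaw L d σ ν)).symm

theorem integral_regret_le (hL : 2 ≤ L) (hK : ∀ w s, (oracle w s).card ≤ K)
    (hmeas : ∀ A, MeasurableSet {q : (Fin L → ℝ) × S | oracle q.1 q.2 = A})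
    (p : Belief d) (hp : p.2.PosDef) {γ : ℝ} (hγ : 0 < γ) :
    ∫ q, (setReturn (oracle (linWeight Φ (gaussianSample p q.1)) q.2.1)
          (linWeight Φ (gaussianSample p q.1) + q.2.2.2.2)
        - setReturn (chooseSet Φ oracle p q.2.2)
          (linWeight Φ (gaussianSample p q.1) + q.2.2.2.2)) ∂freshLaw L d σ ν
      ≤ ∫ q, (K / γ * totalVar Φ p (chooseSet Φ oracle p q.2.2)
          + γ * (8 * min (Real.log L) d)) / 2 ∂freshLaw L d σ ν := by
  set u : Fin L → Param d := fun e => Matrix.toEuclideanCLM (𝕜 := ℝ) (CFC.sqrt p.2) (feature Φ e)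
  set Y : Param d → Fin L → ℝ := fun z e => inner ℝ (u e) z
  set B : Param d × S → Finset (Fin L) := fun y => oracle (linWeight Φ (gaussianSample p y.1)) y.2
  have hB : Measurable B :=
    (measurable_oracle_gaussianSample hmeas).comp (measurable_prodMk_left (x := p))
  have hlin (z : Param d) : linWeight Φ (gaussianSample p z) = linWeight Φ p.1 + Y z := by
    ext e
    unfold linWeight
    exact dotProduct_gaussianSample p (feature Φ e) z
  have hY (e : Fin L) : Integrable (fun z => Y z e) (stdGaussian (Param d)) :=
    integrable_inner_stdGaussian _
  -- The crux of posterior sampling: `A*` and `A^t` are the same map `B`, applied to independent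
  -- pairs (direction, seed) with the same law.
  have hchoose (x : EpisodeNoise L d S) : chooseSet Φ oracle p x = B (x.1, x.2.1) := rfl
  have href (z : Param d) (s : S) : oracle (linWeight Φ (gaussianSample p z)) s = B (z, s) := rfl
  simp only [hchoose, href]
  simp only [hlin]
  -- the relevant marginals
  have m1 : MeasurePreserving (fun q : Param d × S × EpisodeNoise L d S => (q.1, q.2.1))
      (freshLaw L d σ ν) ((stdGaussian (Param d)).prod ν) :=
    measurePreserving_fst.comp measurePreserving_fresh_assoc
  have m2 : MeasurePreserving (fun q : Param d × S × EpisodeNoise L d S => (q.2.2.1, q.2.2.2.1))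
      (freshLaw L d σ ν) ((stdGaussian (Param d)).prod ν) :=
    (measurePreserving_episode_seed.comp measurePreserving_snd).comp measurePreserving_snd
  have m3 : MeasurePreserving (fun q : Param d × S × EpisodeNoise L d S =>
      ((q.1, q.2.1), q.2.2.2.2)) (freshLaw L d σ ν)
      (((stdGaussian (Param d)).prod ν).prod (noiseLaw L σ)) :=
    ((MeasurePreserving.id _).prod measurePreserving_episode_noise).comp
      measurePreserving_fresh_assoc
  have m4 : MeasurePreserving (fun q : Param d × S × EpisodeNoise L d S =>
      ((q.2.2.1, q.2.2.2.1), q.2.2.2.2)) (freshLaw L d σ ν)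
      (((stdGaussian (Param d)).prod ν).prod (noiseLaw L σ)) :=
    (measurePreserving_episode_assoc.comp measurePreserving_snd).comp measurePreserving_snd
  have m5 : MeasurePreserving (fun q : Param d × S × EpisodeNoise L d S =>
      ((q.2.2.1, q.2.2.2.1), q.1)) (freshLaw L d σ ν)
      (((stdGaussian (Param d)).prod ν).prod (stdGaussian (Param d))) :=
    Measure.measurePreserving_swap.comp ((MeasurePreserving.id _).prod
      (measurePreserving_episode_seed.comp measurePreserving_snd))
  have m6 : MeasurePreserving (fun q : Param d × S × EpisodeNoise L d S => q.1)
      (freshLaw L d σ ν) (stdGaussian (Param d)) := measurePreserving_fst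
  -- integrability and integrals of the pieces
  have iη (e : Fin L) : Integrable (fun q : Param d × S × EpisodeNoise L d S => q.2.2.2.2 e)
      (freshLaw L d σ ν) :=
    ((measurePreserving_episode_noise.comp measurePreserving_snd).comp
      measurePreserving_snd).integrable_comp_of_integrable (integrable_noiseLaw_eval e)
  have iY (e : Fin L) : Integrable (fun q : Param d × S × EpisodeNoise L d S => Y q.1 e)
      (freshLaw L d σ ν) := m6.integrable_comp_of_integrable (hY e)
  have ic (e : Fin L) : Integrable (fun _ : Param d × S × EpisodeNoise L d S => linWeight Φ p.1 e)
      (freshLaw L d σ ν) := integrable_const _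
  have iret {A : Param d × S × EpisodeNoise L d S → Finset (Fin L)} (hA : Measurable A)
      {v : Param d × S × EpisodeNoise L d S → Fin L → ℝ}
      (hv : ∀ e, Integrable (fun q => v q e) (freshLaw L d σ ν)) :=
    integrable_setReturn hA hv
  have hB0 : Measurable fun q : Param d × S × EpisodeNoise L d S => B (q.1, q.2.1) :=
    hB.comp m1.measurable
  have hB1 : Measurable fun q : Param d × S × EpisodeNoise L d S => B (q.2.2.1, q.2.2.2.1) :=
    hB.comp m2.measurable
  have hYm : Measurable Y := measurable_pi_iff.2 fun e => measurable_inner_left (u e)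
  have z1 : ∫ q, setReturn (B (q.1, q.2.1)) (linWeight Φ p.1) ∂freshLaw L d σ ν
      = ∫ q, setReturn (B (q.2.2.1, q.2.2.2.1)) (linWeight Φ p.1) ∂freshLaw L d σ ν := by
    have hg : Measurable fun y => setReturn (B y) (linWeight Φ p.1) :=
      measurable_setReturn.comp (hB.prodMk measurable_const)
    exact (m1.integral_comp_of_measurable hg).trans (m2.integral_comp_of_measurable hg).symm
  have hgη : Measurable fun y : (Param d × S) × (Fin L → ℝ) => setReturn (B y.1) y.2 :=
    measurable_setReturn.comp ((hB.comp measurable_fst).prodMk measurable_snd)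
  have zη := integral_prod_setReturn_eq_zero (μ := (stdGaussian (Param d)).prod ν) hB
    (integrable_noiseLaw_eval (L := L) (σ := σ)) integral_noiseLaw_eval
  have z3 : ∫ q, setReturn (B (q.1, q.2.1)) q.2.2.2.2 ∂freshLaw L d σ ν = 0 :=
    (m3.integral_comp_of_measurable hgη).trans zη
  have z4 : ∫ q, setReturn (B (q.2.2.1, q.2.2.2.1)) q.2.2.2.2 ∂freshLaw L d σ ν = 0 :=
    (m4.integral_comp_of_measurable hgη).trans zη
  have z5 : ∫ q, setReturn (B (q.2.2.1, q.2.2.2.1)) (Y q.1) ∂freshLaw L d σ ν = 0 := by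
    have hg : Measurable fun y : (Param d × S) × Param d => setReturn (B y.1) (Y y.2) :=
      measurable_setReturn.comp ((hB.comp measurable_fst).prodMk (hYm.comp measurable_snd))
    exact (m5.integral_comp_of_measurable hg).trans (integral_prod_setReturn_eq_zero hB hY
      fun e => integral_inner_stdGaussian (u e))
  -- Each return splits into posterior mean, fluctuation and noise. The two mean parts agree by
  -- equality of laws, and all remaining parts vanish except the fluctuation along `A*`.
  have hsplit : ∫ q, (setReturn (B (q.1, q.2.1)) (linWeight Φ p.1 + Y q.1 + q.2.2.2.2)
        - setReturn (B (q.2.2.1, q.2.2.2.1)) (linWeight Φ p.1 + Y q.1 + q.2.2.2.2))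
          ∂freshLaw L d σ ν
      = ∫ q, setReturn (B (q.1, q.2.1)) (Y q.1) ∂freshLaw L d σ ν := by
    simp only [setReturn_add]
    rw [integral_add_add_sub (iret hB0 ic) (iret hB0 iY) (iret hB0 iη) (iret hB1 ic) (iret hB1 iY)
      (iret hB1 iη), z1, z3, z4, z5]
    ring
  rw [hsplit]
  obtain ⟨M, hMi, hM0, hM, hMle⟩ := exists_integrable_bound_sq_inner hL u
  have hV (A : Finset (Fin L)) : ∑ e ∈ A, ‖u e‖ ^ 2 = totalVar Φ p A := by
    unfold totalVar
    exact Finset.sum_congr rfl fun e _ => norm_sq_sqrt_apply hp.posSemidef (feature Φ e)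
  have hVm : Measurable fun y : Param d × S => totalVar Φ p (B y) :=
    (measurable_totalVar Φ).comp (measurable_const.prodMk hB)
  have hVi : Integrable (fun y : Param d × S => totalVar Φ p (B y))
      ((stdGaussian (Param d)).prod ν) := by
    refine Integrable.of_bound hVm.aestronglyMeasurable (totalVar Φ p Finset.univ)
      (ae_of_all _ fun y => ?_)
    have h0 (A : Finset (Fin L)) : 0 ≤ totalVar Φ p A := by
      rw [← hV]
      positivity
    rw [Real.norm_of_nonneg (h0 _), ← hV, ← hV]
    exact Finset.sum_le_sum_of_subset_of_nonneg (Finset.subset_univ _) fun e _ _ => by positivity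
  have hVi0 : Integrable (fun q : Param d × S × EpisodeNoise L d S =>
      totalVar Φ p (B (q.1, q.2.1))) (freshLaw L d σ ν) := m1.integrable_comp_of_integrable hVi
  have hVi1 : Integrable (fun q : Param d × S × EpisodeNoise L d S =>
      totalVar Φ p (B (q.2.2.1, q.2.2.2.1))) (freshLaw L d σ ν) :=
    m2.integrable_comp_of_integrable hVi
  have hMi0 : Integrable (fun q : Param d × S × EpisodeNoise L d S => M q.1) (freshLaw L d σ ν) :=
    m6.integrable_comp_of_integrable hMi
  have hMle0 : ∫ q, M q.1 ∂freshLaw L d σ ν ≤ 8 * min (Real.log L) d := by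
    have h := integral_fun_fst (μ := stdGaussian (Param d)) (ν := ν.prod (episodeLaw L d σ ν)) M
    rw [probReal_univ, one_smul] at h
    exact h.trans_le hMle
  have hVeq : ∫ q, totalVar Φ p (B (q.1, q.2.1)) ∂freshLaw L d σ ν
      = ∫ q, totalVar Φ p (B (q.2.2.1, q.2.2.2.1)) ∂freshLaw L d σ ν :=
    (m1.integral_comp_of_measurable hVm).trans (m2.integral_comp_of_measurable hVm).symm
  calc ∫ q, setReturn (B (q.1, q.2.1)) (Y q.1) ∂freshLaw L d σ ν
      ≤ ∫ q, (K / γ * totalVar Φ p (B (q.1, q.2.1)) + γ * M q.1) / 2 ∂freshLaw L d σ ν := by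
        refine integral_mono (iret hB0 iY) (((hVi0.const_mul _).add (hMi0.const_mul _)).div_const _)
          fun q => ?_
        have h := setReturn_inner_le (hK _ _ : (B (q.1, q.2.1)).card ≤ K) (hM0 q.1)
          (fun e => hM e q.1) hγ
        rwa [hV] at h
    _ = (K / γ * ∫ q, totalVar Φ p (B (q.1, q.2.1)) ∂freshLaw L d σ ν
          + γ * ∫ q, M q.1 ∂freshLaw L d σ ν) / 2 := by
        rw [integral_div, integral_add (hVi0.const_mul _) (hMi0.const_mul _), integral_const_mul,
          integral_const_mul]
    _ ≤ (K / γ * ∫ q, totalVar Φ p (B (q.2.2.1, q.2.2.2.1)) ∂freshLaw L d σ ν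
          + γ * (8 * min (Real.log L) d)) / 2 := by
        rw [hVeq]
        gcongr
    _ = _ := by
        rw [integral_div, integral_add (hVi1.const_mul _) (integrable_const _), integral_const_mul,
          integral_const, probReal_univ, one_smul]

end EpisodeRegret

/-! ### Summation over episodes -/

section Regret

attribute [local irreducible] gaussianSample linWeight totalVar setReturn

variable {L d K : ℕ} {S : Type*} [MeasurableSpace S] {Φ : Matrix (Fin L) (Fin d) ℝ} {lam σ : ℝ}
  {oracle : (Fin L → ℝ) → S → Finset (Fin L)} {ν : Measure S} [IsProbabilityMeasure ν]

theorem integrable_weight (t : ℕ) (e : Fin L) :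
    Integrable (fun ω : Sample L d S => weight Φ t ω e) (law L d lam σ ν) := by
  have h1 : Integrable (fun ω : Sample L d S => linWeight Φ ω.1 e) (law L d lam σ ν) := by
    have h : Integrable (fun θ : Param d => linWeight Φ θ e)
        (multivariateGaussian (0 : Param d) (lam ^ 2 • (1 : Matrix (Fin d) (Fin d) ℝ))) := by
      have he (θ : Param d) : linWeight Φ θ e = innerSL ℝ (feature Φ e) θ := by
        unfold linWeight
        exact (inner_eq_dotProduct (feature Φ e) θ).symm
      simp_rw [he]
      exact (innerSL ℝ (feature Φ e)).integrable_comp IsGaussian.integrable_id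
    exact h.comp_fst _
  have h2 : MeasurePreserving (fun ω : Sample L d S => (ω.2.2 t).2.2) (law L d lam σ ν)
      (noiseLaw L σ) :=
    measurePreserving_episode_noise.comp (((measurePreserving_eval_infinitePi
      (fun _ : ℕ => episodeLaw L d σ ν) t).comp measurePreserving_snd).comp measurePreserving_snd)
  exact h1.add (h2.integrable_comp_of_integrable (integrable_noiseLaw_eval e))

theorem integrable_realizedRegret
    (hmeas : ∀ A, MeasurableSet {q : (Fin L → ℝ) × S | oracle q.1 q.2 = A}) (t : ℕ) :
    Integrable (realizedRegret Φ lam σ oracle t) (law L d lam σ ν) :=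
  (integrable_setReturn (measurable_refSet hmeas) (integrable_weight t)).sub
    (integrable_setReturn (measurable_chosenSet hmeas t) (integrable_weight t))

/-- Expectation computed by conditioning on the belief. Integrability of the inner integral is
included so that two such expectations can be compared belief by belief. -/
theorem integral_law_eq (hΦ : ∀ e, ‖feature Φ e‖ ≤ 1) (hσ : 0 < σ) (hlam : 0 < lam)
    (hmeas : ∀ A, MeasurableSet {q : (Fin L → ℝ) × S | oracle q.1 q.2 = A}) (t : ℕ)
    {H : Belief d × Param d × S × EpisodeNoise L d S → ℝ} (hH : Measurable H)
    (hHi : Integrable (fun ω => H (belief Φ lam σ oracle t ω, ω.1, ω.2.1, ω.2.2 t))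
      (law L d lam σ ν)) :
    Integrable (fun ω => ∫ q, H (belief Φ lam σ oracle t ω,
        gaussianSample (belief Φ lam σ oracle t ω) q.1, q.2.1, q.2.2) ∂freshLaw L d σ ν)
        (law L d lam σ ν) ∧
      ∫ ω, H (belief Φ lam σ oracle t ω, ω.1, ω.2.1, ω.2.2 t) ∂law L d lam σ ν
        = ∫ ω, ∫ q, H (belief Φ lam σ oracle t ω,
            gaussianSample (belief Φ lam σ oracle t ω) q.1, q.2.1, q.2.2) ∂freshLaw L d σ ν
          ∂law L d lam σ ν := by
  have := isProbabilityMeasure_beliefLaw (ν := ν) (Φ := Φ) (lam := lam) (σ := σ) hmeas t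
  have hB := measurable_belief (Φ := Φ) (lam := lam) (σ := σ) hmeas t
  have hm1 : Measurable fun ω : Sample L d S =>
      (belief Φ lam σ oracle t ω, ω.1, ω.2.1, ω.2.2 t) :=
    hB.prodMk (measurable_fst.prodMk (measurable_snd.fst.prodMk
      ((measurable_pi_apply t).comp measurable_snd.snd)))
  have hm2 : Measurable fun q : Belief d × Param d × S × EpisodeNoise L d S =>
      (q.1, gaussianSample q.1 q.2.1, q.2.2.1, q.2.2.2) :=
    measurable_fst.prodMk ((measurable_gaussianSample.comp
      (measurable_fst.prodMk measurable_snd.fst)).prodMk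
        (measurable_snd.snd.fst.prodMk measurable_snd.snd.snd))
  have hmap := map_belief_eq (ν := ν) hΦ hσ hlam hmeas t
  have hi2 : Integrable (fun q : Belief d × Param d × S × EpisodeNoise L d S =>
      H (q.1, gaussianSample q.1 q.2.1, q.2.2.1, q.2.2.2))
      ((beliefLaw ν Φ lam σ oracle t).prod (freshLaw L d σ ν)) := by
    have h1 := (integrable_map_measure hH.aestronglyMeasurable hm1.aemeasurable).2 hHi
    rw [hmap] at h1
    exact (integrable_map_measure hH.aestronglyMeasurable hm2.aemeasurable).1 h1
  have hi3 := hi2.integral_prod_left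
  have hi4 := (integrable_map_measure (μ := law L d lam σ ν) (f := belief Φ lam σ oracle t)
    hi3.aestronglyMeasurable hB.aemeasurable).1 hi3
  refine ⟨hi4, ?_⟩
  have e1 := integral_map (μ := law L d lam σ ν) hm1.aemeasurable
    (hH.aestronglyMeasurable (μ := _))
  have e2 := integral_map (μ := (beliefLaw ν Φ lam σ oracle t).prod (freshLaw L d σ ν))
    hm2.aemeasurable (hH.aestronglyMeasurable (μ := _))
  rw [← e1, hmap, e2, integral_prod _ hi2]
  exact integral_map hB.aemeasurable hi3.aestronglyMeasurable

theorem integrable_totalVar (hΦ : ∀ e, ‖feature Φ e‖ ≤ 1) (hσ : 0 < σ) (hlam : 0 < lam)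
    (hK : ∀ w s, (oracle w s).card ≤ K)
    (hmeas : ∀ A, MeasurableSet {q : (Fin L → ℝ) × S | oracle q.1 q.2 = A}) (t : ℕ) :
    Integrable (fun ω => totalVar Φ (belief Φ lam σ oracle t ω) (chosenSet Φ lam σ oracle t ω))
      (law L d lam σ ν) := by
  refine Integrable.of_bound ((measurable_totalVar Φ).comp ((measurable_belief hmeas t).prodMk
    (measurable_chosenSet hmeas t))).aestronglyMeasurable (K * lam ^ 2) (ae_of_all _ fun ω => ?_)
  have hc : (chosenSet Φ lam σ oracle t ω).card ≤ K := hK _ _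
  rw [Real.norm_of_nonneg (totalVar_belief_nonneg hΦ hσ hlam ω t _)]
  exact totalVar_belief_le hΦ hσ hlam hK ω t hc

theorem integral_realizedRegret_le (hΦ : ∀ e, ‖feature Φ e‖ ≤ 1) (hσ : 0 < σ) (hlam : 0 < lam)
    (hL : 2 ≤ L) (hK : ∀ w s, (oracle w s).card ≤ K)
    (hmeas : ∀ A, MeasurableSet {q : (Fin L → ℝ) × S | oracle q.1 q.2 = A}) (t : ℕ) {γ : ℝ}
    (hγ : 0 < γ) :
    ∫ ω, realizedRegret Φ lam σ oracle t ω ∂law L d lam σ ν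
      ≤ (K / γ * ∫ ω, totalVar Φ (belief Φ lam σ oracle t ω) (chosenSet Φ lam σ oracle t ω)
          ∂law L d lam σ ν + γ * (8 * min (Real.log L) d)) / 2 := by
  have hV := integrable_totalVar (ν := ν) hΦ hσ hlam hK hmeas t
  have hc : Measurable fun q : Belief d × Param d × S × EpisodeNoise L d S =>
      chooseSet Φ oracle q.1 q.2.2.2 :=
    (measurable_chooseSet hmeas).comp (measurable_fst.prodMk measurable_snd.snd.snd)
  have hw : Measurable fun q : Belief d × Param d × S × EpisodeNoise L d S =>
      linWeight Φ q.2.1 + q.2.2.2.2.2 :=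
    ((measurable_linWeight Φ).comp measurable_snd.fst).add measurable_snd.snd.snd.snd.snd
  have ho : Measurable fun q : Belief d × Param d × S × EpisodeNoise L d S =>
      oracle (linWeight Φ q.2.1) q.2.2.1 :=
    (measurable_oracle hmeas).comp
      (((measurable_linWeight Φ).comp measurable_snd.fst).prodMk measurable_snd.snd.fst)
  obtain ⟨i1, h1⟩ := integral_law_eq (ν := ν) hΦ hσ hlam hmeas t
    (H := fun q => setReturn (oracle (linWeight Φ q.2.1) q.2.2.1)
          (linWeight Φ q.2.1 + q.2.2.2.2.2)
        - setReturn (chooseSet Φ oracle q.1 q.2.2.2) (linWeight Φ q.2.1 + q.2.2.2.2.2))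
    ((measurable_setReturn.comp (ho.prodMk hw)).sub (measurable_setReturn.comp (hc.prodMk hw)))
    (integrable_realizedRegret hmeas t)
  -- Applied to the upper bound as well, to return from the fresh copy of the chosen set to the real
  -- one.
  obtain ⟨i2, h2⟩ := integral_law_eq (ν := ν) hΦ hσ hlam hmeas t
    (H := fun q => (K / γ * totalVar Φ q.1 (chooseSet Φ oracle q.1 q.2.2.2)
          + γ * (8 * min (Real.log L) d)) / 2)
    (((((measurable_totalVar Φ).comp (measurable_fst.prodMk hc)).const_mul _).add_const _).div_const
      _) (((hV.const_mul _).add (integrable_const _)).div_const _)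
  have h3 : ∫ ω, (K / γ * totalVar Φ (belief Φ lam σ oracle t ω) (chosenSet Φ lam σ oracle t ω)
      + γ * (8 * min (Real.log L) d)) / 2 ∂law L d lam σ ν
      = (K / γ * ∫ ω, totalVar Φ (belief Φ lam σ oracle t ω) (chosenSet Φ lam σ oracle t ω)
          ∂law L d lam σ ν + γ * (8 * min (Real.log L) d)) / 2 := by
    rw [integral_div, integral_add (hV.const_mul _) (integrable_const _), integral_const_mul,
      integral_const, probReal_univ, one_smul]
  rw [← h3]
  refine (h1.le.trans (integral_mono i1 i2 fun ω => ?_)).trans h2.ge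
  exact integral_regret_le hL hK hmeas _ (belief_posDef hΦ hσ hlam ω t) hγ

theorem le_sqrt_mul_of_forall_le {R a b : ℝ} (ha : 0 ≤ a) (hb : 0 ≤ b)
    (h : ∀ γ : ℝ, 0 < γ → R ≤ (a / γ + γ * b) / 2) : R ≤ √(a * b) := by
  rcases le_or_gt R 0 with hR | hR
  · exact hR.trans (Real.sqrt_nonneg _)
  refine Real.le_sqrt_of_sq_le ?_
  rcases hb.eq_or_lt with rfl | hb
  · have h1 := h ((a + 1) / R) (by positivity)
    have h2 : a / ((a + 1) / R) = R - R / (a + 1) := by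
      field_simp
      ring
    have h3 : 0 < R / (a + 1) := by positivity
    rw [h2] at h1
    linarith
  · have h1 := h (R / b) (by positivity)
    have h2 : a / (R / b) + R / b * b = (a * b + R ^ 2) / R := by
      field_simp
    rw [h2, le_div_iff₀ two_pos, le_div_iff₀ hR] at h1
    nlinarith

theorem sum_integral_totalVar_le (hΦ : ∀ e, ‖feature Φ e‖ ≤ 1) (hσ : 0 < σ) (hlam : σ ≤ lam)
    (hK : ∀ w s, (oracle w s).card ≤ K)
    (hmeas : ∀ A, MeasurableSet {q : (Fin L → ℝ) × S | oracle q.1 q.2 = A}) {n : ℕ}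
    (hn : 1 ≤ n) (hK1 : 1 ≤ K) (hd : 1 ≤ d) :
    ∑ t ∈ Finset.range n, ∫ ω, totalVar Φ (belief Φ lam σ oracle t ω)
        (chosenSet Φ lam σ oracle t ω) ∂law L d lam σ ν
      ≤ K * lam ^ 2 * d * (1 + Real.log (n * d) / Real.log 2) := by
  have hi (t : ℕ) := integrable_totalVar (ν := ν) hΦ hσ (hσ.trans_le hlam) hK hmeas t
  rw [← integral_finsetSum _ fun t _ => hi t]
  refine (integral_mono (integrable_finsetSum _ fun t _ => hi t) (integrable_const _) fun ω =>
    sum_totalVar_le hΦ hσ hlam hK ω hn hK1 hd).trans_eq ?_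
  rw [integral_const, probReal_univ, one_smul]

theorem log_factor_le {n K d : ℕ} (hn : 1 ≤ n) (hK : 1 ≤ K) (hd : 1 ≤ d) :
    1 ≤ Real.log (2 + n * K * d) ∧
      1 + Real.log (n * d) / Real.log 2 ≤ 3 * Real.log (2 + n * K * d) := by
  have hn' : (1 : ℝ) ≤ n := by exact_mod_cast hn
  have hK' : (1 : ℝ) ≤ K := by exact_mod_cast hK
  have hd' : (1 : ℝ) ≤ d := by exact_mod_cast hd
  have h1 : (1 : ℝ) ≤ n * d := one_le_mul_of_one_le_of_one_le hn' hd'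
  have h2 : (n * d : ℝ) ≤ n * K * d := by
    have := le_mul_of_one_le_right (by positivity : (0 : ℝ) ≤ n * d) hK'
    linarith
  have h3 : 1 ≤ Real.log (2 + n * K * d) := by
    -- Here `2 + nKd ≥ 3 > e`.
    rw [Real.le_log_iff_exp_le (by positivity)]
    have := Real.exp_one_lt_d9
    linarith
  refine ⟨h3, ?_⟩
  have h4 : Real.log (n * d) ≤ Real.log (2 + n * K * d) :=
    Real.log_le_log (by linarith) (by linarith)
  have h5 : 0 ≤ Real.log (n * d) := Real.log_nonneg h1
  have h6 : Real.log (n * d) / Real.log 2 ≤ 2 * Real.log (n * d) := by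
    rw [div_le_iff₀ (Real.log_pos one_lt_two)]
    nlinarith [Real.log_two_gt_d9]
  linarith

theorem bayesRegret_le (hΦ : ∀ e, ‖feature Φ e‖ ≤ 1) (hσ : 0 < σ) (hlam : σ ≤ lam)
    (hL : 2 ≤ L) (hK : ∀ w s, (oracle w s).card ≤ K)
    (hmeas : ∀ A, MeasurableSet {q : (Fin L → ℝ) × S | oracle q.1 q.2 = A}) (n : ℕ) :
    bayesRegret Φ lam σ oracle ν n ≤
      5 * Real.log (2 + n * K * d) ^ 1 * (K * lam * √(d * n * min (Real.log L) d)) := by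
  have hlam0 := hσ.trans_le hlam
  have hmin : 0 ≤ min (Real.log L) (d : ℝ) := le_min (Real.log_natCast_nonneg L) (by positivity)
  set V : ℝ := ∑ t ∈ Finset.range n, ∫ ω, totalVar Φ (belief Φ lam σ oracle t ω)
    (chosenSet Φ lam σ oracle t ω) ∂law L d lam σ ν with hV
  have hV0 : 0 ≤ V := Finset.sum_nonneg fun t _ => integral_nonneg fun ω =>
    totalVar_belief_nonneg hΦ hσ hlam0 ω t _
  -- One `γ` serves all episodes and is optimized only after the summation.
  have h1 : bayesRegret Φ lam σ oracle ν n ≤ √(K * V * (n * (8 * min (Real.log L) d))) := by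
    refine le_sqrt_mul_of_forall_le (by positivity) (by positivity) fun γ hγ => ?_
    calc bayesRegret Φ lam σ oracle ν n
        ≤ ∑ t ∈ Finset.range n, (K / γ * ∫ ω, totalVar Φ (belief Φ lam σ oracle t ω)
          (chosenSet Φ lam σ oracle t ω) ∂law L d lam σ ν + γ * (8 * min (Real.log L) d)) / 2 :=
          Finset.sum_le_sum fun t _ => integral_realizedRegret_le hΦ hσ hlam0 hL hK hmeas t hγ
      _ = _ := by
          rw [← Finset.sum_div, Finset.sum_add_distrib, ← Finset.mul_sum, ← hV, Finset.sum_const,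
            Finset.card_range, nsmul_eq_mul]
          ring
  have hlog0 : 0 ≤ Real.log (2 + n * K * d) := by
    refine Real.log_nonneg ?_
    have : (0 : ℝ) ≤ n * K * d := by positivity
    linarith
  have hrhs : 0 ≤ 5 * Real.log (2 + n * K * d) ^ 1
      * (K * lam * √(d * n * min (Real.log L) d)) := by positivity
  by_cases hpos : 1 ≤ n ∧ 1 ≤ K ∧ 1 ≤ d
  · obtain ⟨hn, hK1, hd⟩ := hpos
    obtain ⟨g1, g2⟩ := log_factor_le hn hK1 hd
    have h2 := sum_integral_totalVar_le (ν := ν) hΦ hσ hlam hK hmeas hn hK1 hd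
    refine h1.trans (Real.sqrt_le_iff.2 ⟨hrhs, ?_⟩)
    have h3 : V ≤ K * lam ^ 2 * d * (3 * Real.log (2 + n * K * d)) :=
      h2.trans (mul_le_mul_of_nonneg_left g2 (by positivity))
    generalize Real.log (2 + n * K * d) = l at *
    have hD : (0 : ℝ) ≤ d * n * min (Real.log L) d := by positivity
    rw [mul_pow, mul_pow, mul_pow, mul_pow, Real.sq_sqrt hD]
    calc K * V * (n * (8 * min (Real.log L) d))
        ≤ K * (K * lam ^ 2 * d * (3 * l)) * (n * (8 * min (Real.log L) d)) := by gcongr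
      _ = 24 * l * (K ^ 2 * lam ^ 2 * (d * n * min (Real.log L) d)) := by ring
      -- The `24` is `8` from the maximal inequality times `3` from the potential; `24 l ≤ 25 l²` as
      -- `l ≥ 1`, whence the constant `5`.
      _ ≤ 5 ^ 2 * (l ^ 1) ^ 2 * (K ^ 2 * lam ^ 2 * (d * n * min (Real.log L) d)) := by
          refine mul_le_mul_of_nonneg_right ?_ (by positivity)
          nlinarith
  -- If `n`, `K` or `d` is zero the logarithm may be less than `1`, but the bound `h1` is already
  -- zero; for `d = 0` this is because the minimum is `0`.
  · have h0 : K * V * (n * (8 * min (Real.log L) d)) = 0 := by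
      rcases Nat.eq_zero_or_pos n with rfl | hn
      · simp
      rcases Nat.eq_zero_or_pos K with rfl | hK1
      · simp
      rcases Nat.eq_zero_or_pos d with rfl | hd
      · simp [Real.log_natCast_nonneg]
      exact absurd ⟨hn, hK1, hd⟩ hpos
    rw [h0, Real.sqrt_zero] at h1
    exact h1.trans hrhs

end Regret

end CombLinTS

theorem theorem1 :
    ∃ C : ℝ, 0 < C ∧ ∃ p : ℕ,
      ∀ (L d K n : ℕ) (hL : 2 ≤ L)
        (Φ : Matrix (Fin L) (Fin d) ℝ) (hΦ : ∀ e, ‖CombLinTS.feature Φ e‖ ≤ 1)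
        (lam σ : ℝ) (hσ : 0 < σ) (hlam : σ ≤ lam)
        (𝒜 : Set (Finset (Fin L))) (hK : ∀ A ∈ 𝒜, A.card ≤ K)
        (S : Type*) [MeasurableSpace S] (ν : Measure S) [IsProbabilityMeasure ν]
        (oracle : (Fin L → ℝ) → S → Finset (Fin L))
        (hmeas : ∀ A, MeasurableSet {q : (Fin L → ℝ) × S | oracle q.1 q.2 = A})
        (horacle : ∀ w s, oracle w s ∈ 𝒜),
        (∀ t, Integrable (CombLinTS.realizedRegret Φ lam σ oracle t)
          (CombLinTS.law L d lam σ ν)) ∧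
        CombLinTS.bayesRegret Φ lam σ oracle ν n ≤
          C * Real.log (2 + n * K * d) ^ p *
            (K * lam * √(d * n * min (Real.log L) d)) := by
  refine ⟨5, by norm_num, 1, fun L d K n hL Φ hΦ lam σ hσ hlam 𝒜 hK S _ ν _ oracle hmeas horacle =>
    ⟨CombLinTS.integrable_realizedRegret hmeas, ?_⟩⟩
  exact CombLinTS.bayesRegret_le hΦ hσ hlam hL (fun w s => hK _ (horacle w s)) hmeas n
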